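/- An arch system is a non-crossing matching of $2n$ points on a line by $n$ arches drawn above it (equivalently, a Dyck word of semilength $n$); $n\ge 0$ is its size. Write $AB$ for concatenation and $\overline{A}$ for the system obtained by adding one arch outside all of $A$. An atom is a non-empty arch system that is not a concatenation of two non-empty ones. Let $\sim$ be the finest equivalence relation on arch systems such that $$A\sim B\Rightarrow \overline{A}\sim\overline{B},\qquad a\sim b\Rightarrow PaQ\sim PbQ,\qquad PabQ\sim PbaQ,\qquad a\,\overline{bc}\sim\overline{ab}\,c,$$ for all arch systems $A,B,P,Q$ and all $a,b,c$ each of which is an atom or empty. Its equivalence classes are called cohorts; equivalent systems have the same size, which is the size of the cohort. A cohort is atomic if it contains at least one atom. Let $\mathcal A$ and $\mathcal B$ be the combinatorial classes of non-plane tree-like structures given recursively, up to size-preserving bijection, by $$\mathcal A=\bullet\ \uplus\ (\bullet,\mathcal A)\ \uplus\ \biguplus_{k\ge2}\bigl(\triangle_{k-1},\mathrm{MSet}_k(\mathcal B)\bigr)\ \uplus\ \mathcal B,\qquad \mathcal B=\bigl(\bullet,\mathrm{MSet}_{\ge3}(\mathcal A)\bigr),$$ where $\bullet$ is a class with a single object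 of size $1$, $\triangle_m$ is a class with a single object of size $m$, parentheses denote ordered pairs, $\mathrm{MSet}$ denotes multisets with the indicated number of elements, and sizes add. **Proposition.** There is a size-preserving bijection between atomic cohorts and $\mathcal A$. Consequently there are finitely many atomic cohorts, and finitely many objects of $\mathcal B$, of each size, and the generating functions $A(t)=\sum_n a_nt^n$ and $B(t)=\sum_n b_nt^n$, where $a_n$ is the number of atomic cohorts of size $n$ and $b_n$ the number of objects of $\mathcal B$ of size $n$, satisfy, as formal power series, $$A=t+tA+\frac1t M_{\ge2}(tB)+B,\qquad B=t\,M_{\ge3}(A),$$ where, for a power series $Z$ with $Z(0)=0$, $$M(Z)=\exp\Bigl(\sum_{k\ge1}\tfrac{Z(t^k)}{k}\Bigr),\qquad M_{\ge2}(Z)=M(Z)-1-Z(t),\qquad M_{\ge3}(Z)=M(Z)-1-Z(t)-\tfrac12\bigl(Z(t)^2+Z(t^2)\bigr).$$ -/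

import Mathlib

/-! ### Arch systems and cohorts

An arch system is encoded by its word of matched parentheses, that is, by a Dyck word: the left end
of each arch is a step `U`, its right end the matching step `D`.  Concatenation of arch systems is
`+`, the empty arch system is `0`, the number of arches is `DyckWord.semilength`, and
`DyckWord.nest A` is `A` with a single arch added outside all of it. -/

/-- An atom is a non-empty arch system that is not the concatenation of two non-empty ones. -/
def IsAtomArch (a : DyckWord) : Prop :=
  a ≠ 0 ∧ ∀ p q : DyckWord, a = p + q → p = 0 ∨ q = 0

/-- An atom or the empty arch system. -/
def IsAtomOrEmpty (a : DyckWord) : Prop :=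
  a = 0 ∨ IsAtomArch a

/-- The finest equivalence relation `∼` on arch systems closed under the four rules. -/
inductive ArchSim : DyckWord → DyckWord → Prop
  | refl (A : DyckWord) : ArchSim A A
  | symm {A B : DyckWord} : ArchSim A B → ArchSim B A
  | trans {A B C : DyckWord} : ArchSim A B → ArchSim B C → ArchSim A C
  | arch {A B : DyckWord} : ArchSim A B → ArchSim A.nest B.nest
  | subst {a b : DyckWord} (P Q : DyckWord) (ha : IsAtomOrEmpty a) (hb : IsAtomOrEmpty b) :
      ArchSim a b → ArchSim (P + a + Q) (P + b + Q)
  | comm {a b : DyckWord} (P Q : DyckWord) (ha : IsAtomOrEmpty a) (hb : IsAtomOrEmpty b) :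
      ArchSim (P + a + b + Q) (P + b + a + Q)
  | rotate {a b c : DyckWord} (ha : IsAtomOrEmpty a) (hb : IsAtomOrEmpty b)
      (hc : IsAtomOrEmpty c) : ArchSim (a + (b + c).nest) ((a + b).nest + c)

/-- Equivalent arch systems have the same number of arches. -/
theorem ArchSim.semilength_eq {A B : DyckWord} (h : ArchSim A B) :
    A.semilength = B.semilength := by
  induction h with
  | refl A => rfl
  | symm _ ih => exact ih.symm
  | trans _ _ ih₁ ih₂ => exact ih₁.trans ih₂
  | arch _ ih => simp [ih]
  | subst P Q _ _ _ ih => simp [ih]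
  | comm P Q _ _ => simp only [DyckWord.semilength_add]; omega
  | rotate _ _ _ => simp only [DyckWord.semilength_add, DyckWord.semilength_nest]; omega

/-- The setoid of `∼`. -/
def archSetoid : Setoid DyckWord where
  r := ArchSim
  iseqv := ⟨ArchSim.refl, ArchSim.symm, ArchSim.trans⟩

/-- Cohorts are the equivalence classes of `∼`. -/
def Cohort : Type := Quotient archSetoid

/-- The cohort of an arch system. -/
def Cohort.mk (A : DyckWord) : Cohort := Quotient.mk archSetoid A

/-- The size of a cohort as a structure: the common number of arches of its members. -/
def Cohort.size : Cohort → ℕ :=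
  Quotient.lift DyckWord.semilength fun _ _ h => ArchSim.semilength_eq h

/-- A cohort is atomic if it contains at least one atom. -/
def Cohort.IsAtomic (C : Cohort) : Prop :=
  ∃ a : DyckWord, IsAtomArch a ∧ Cohort.mk a = C

/-! ### Combinatorial classes -/

/-- A set of objects with a size function. -/
structure CombClass where
  Obj : Type
  size : Obj → ℕ

namespace CombClass

/-- The class with a single object, of size `m`. -/
def point (m : ℕ) : CombClass := ⟨Unit, fun _ => m⟩

/-- Disjoint union of two classes. -/
def union (S T : CombClass) : CombClass := ⟨S.Obj ⊕ T.Obj, Sum.elim S.size T.size⟩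

/-- Disjoint union of a family of classes. -/
def iUnion {ι : Type} (S : ι → CombClass) : CombClass :=
  ⟨Σ i, (S i).Obj, fun x => (S x.1).size x.2⟩

/-- Ordered pairs; the size of a pair is the sum of the sizes. -/
def pair (S T : CombClass) : CombClass := ⟨S.Obj × T.Obj, fun x => S.size x.1 + T.size x.2⟩

/-- Multisets of objects of `S` whose number of elements satisfies `p`; the size is the sum of the
sizes of the elements, counted with multiplicity. -/
def mset (p : ℕ → Prop) (S : CombClass) : CombClass :=
  ⟨{s : Multiset S.Obj // p (Multiset.card s)}, fun s => (s.1.map S.size).sum⟩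

/-- There is a size-preserving bijection between the two classes. -/
def SizeEquiv (S T : CombClass) : Prop :=
  ∃ e : S.Obj ≃ T.Obj, ∀ x, T.size (e x) = S.size x

/-- There are finitely many objects of each size. -/
def FiniteFibers (S : CombClass) : Prop :=
  ∀ n, {x : S.Obj | S.size x = n}.Finite

/-- The ordinary generating function, whose `n`-th coefficient is the number of objects of
size `n` (meaningful for classes with finitely many objects of each size). -/
noncomputable def genFun (S : CombClass) : PowerSeries ℚ :=
  PowerSeries.mk fun n => ({x : S.Obj | S.size x = n}.ncard : ℚ)

end CombClass

/-- The class of atomic cohorts. -/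
def atomicCohorts : CombClass := ⟨{C : Cohort // C.IsAtomic}, fun C => C.1.size⟩

/-! ### The recursively specified classes

First the plane versions, in which the children of a node are listed in an order; then the
non-plane objects are obtained by identifying trees that differ by reordering children. -/

mutual

/-- Plane versions of the objects of `𝒜`: a single node, a node with one child in `𝒜`, a symbol
`△_{k-1}` with `k ≥ 2` children in `ℬ`, or an object of `ℬ`. -/
inductive PlaneA : Type
  | leaf : PlaneA
  | unary (a : PlaneA) : PlaneA
  | tri (k : ℕ) (hk : 2 ≤ k) (f : Fin k → PlaneB) : PlaneA
  | large (b : PlaneB) : PlaneA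

/-- Plane versions of the objects of `ℬ`: a node with at least three children in `𝒜`. -/
inductive PlaneB : Type
  | node (k : ℕ) (hk : 3 ≤ k) (f : Fin k → PlaneA) : PlaneB

end

mutual

/-- The size, where a node has size `1` and `△_{k-1}` has size `k - 1`. -/
def PlaneA.size : PlaneA → ℕ
  | .leaf => 1
  | .unary a => 1 + a.size
  | .tri k _ f => (k - 1) + ∑ i, (f i).size
  | .large b => b.size

/-- The size, where a node has size `1` and `△_{k-1}` has size `k - 1`. -/
def PlaneB.size : PlaneB → ℕ
  | .node _ _ f => 1 + ∑ i, (f i).size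

end

mutual

/-- Equality up to reordering the children of nodes. -/
inductive IsoA : PlaneA → PlaneA → Prop
  | leaf : IsoA .leaf .leaf
  | unary {a a' : PlaneA} : IsoA a a' → IsoA (.unary a) (.unary a')
  | tri {k : ℕ} {hk : 2 ≤ k} {f g : Fin k → PlaneB} (σ : Equiv.Perm (Fin k)) :
      (∀ i, IsoB (f i) (g (σ i))) → IsoA (.tri k hk f) (.tri k hk g)
  | large {b b' : PlaneB} : IsoB b b' → IsoA (.large b) (.large b')

/-- Equality up to reordering the children of nodes. -/
inductive IsoB : PlaneB → PlaneB → Prop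
  | node {k : ℕ} {hk : 3 ≤ k} {f g : Fin k → PlaneA} (σ : Equiv.Perm (Fin k)) :
      (∀ i, IsoA (f i) (g (σ i))) → IsoB (.node k hk f) (.node k hk g)

end

mutual

theorem IsoA.refl : ∀ a, IsoA a a
  | .leaf => .leaf
  | .unary a => .unary (IsoA.refl a)
  | .tri _ _ f => .tri (Equiv.refl _) fun i => IsoB.refl (f i)
  | .large b => .large (IsoB.refl b)

theorem IsoB.refl : ∀ b, IsoB b b
  | .node _ _ f => .node (Equiv.refl _) fun i => IsoA.refl (f i)

end

mutual

theorem IsoA.symm : ∀ {a b}, IsoA a b → IsoA b a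
  | _, _, .leaf => .leaf
  | _, _, .unary h => .unary h.symm
  | _, _, .tri σ h => .tri σ.symm fun i => by
      have := (h (σ.symm i)).symm
      rwa [Equiv.apply_symm_apply] at this
  | _, _, .large h => .large h.symm

theorem IsoB.symm : ∀ {a b}, IsoB a b → IsoB b a
  | _, _, .node σ h => .node σ.symm fun i => by
      have := (h (σ.symm i)).symm
      rwa [Equiv.apply_symm_apply] at this

end

mutual

theorem IsoA.trans : ∀ {a b c}, IsoA a b → IsoA b c → IsoA a c
  | _, _, _, .leaf, .leaf => .leaf
  | _, _, _, .unary h, .unary h' => .unary (h.trans h')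
  | _, _, _, .tri σ h, .tri τ h' => .tri (σ.trans τ) fun i => (h i).trans (h' (σ i))
  | _, _, _, .large h, .large h' => .large (h.trans h')

theorem IsoB.trans : ∀ {a b c}, IsoB a b → IsoB b c → IsoB a c
  | _, _, _, .node σ h, .node τ h' => .node (σ.trans τ) fun i => (h i).trans (h' (σ i))

end

mutual

theorem IsoA.size_eq : ∀ {a b}, IsoA a b → a.size = b.size
  | _, _, .leaf => rfl
  | _, _, .unary h => by simp only [PlaneA.size, h.size_eq]
  | _, _, .tri (g := g) σ h => by
      simp only [PlaneA.size, fun i => (h i).size_eq]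
      rw [Equiv.sum_comp σ fun i => (g i).size]
  | _, _, .large h => by simp only [PlaneA.size, h.size_eq]

theorem IsoB.size_eq : ∀ {a b}, IsoB a b → a.size = b.size
  | _, _, .node (g := g) σ h => by
      simp only [PlaneB.size, fun i => (h i).size_eq]
      rw [Equiv.sum_comp σ fun i => (g i).size]

end

def isoASetoid : Setoid PlaneA := ⟨IsoA, IsoA.refl, IsoA.symm, IsoA.trans⟩

def isoBSetoid : Setoid PlaneB := ⟨IsoB, IsoB.refl, IsoB.symm, IsoB.trans⟩

/-- The class `𝒜` of non-plane tree-like structures. -/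
def classA : CombClass :=
  ⟨Quotient isoASetoid, Quotient.lift PlaneA.size fun _ _ h => IsoA.size_eq h⟩

/-- The class `ℬ` of non-plane tree-like structures. -/
def classB : CombClass :=
  ⟨Quotient isoBSetoid, Quotient.lift PlaneB.size fun _ _ h => IsoB.size_eq h⟩

/-- The right-hand side `• ⊎ (•, 𝒜) ⊎ ⨄_{k ≥ 2} (△_{k-1}, MSet_k(ℬ)) ⊎ ℬ`. -/
def specA (S T : CombClass) : CombClass :=
  ((((CombClass.point 1).union ((CombClass.point 1).pair S)).union
    (CombClass.iUnion fun k : {k : ℕ // 2 ≤ k} =>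
      (CombClass.point (k.1 - 1)).pair (CombClass.mset (fun j => j = k.1) T))).union T)

/-- The right-hand side `(•, MSet_{≥ 3}(𝒜))`. -/
def specB (S : CombClass) : CombClass :=
  (CombClass.point 1).pair (CombClass.mset (fun j => 3 ≤ j) S)

/-! ### The multiset operators on power series -/

/-- The series `Z(t^k)`, for `k ≥ 1`. -/
noncomputable def dilate (k : ℕ) (Z : PowerSeries ℚ) : PowerSeries ℚ :=
  PowerSeries.subst ((PowerSeries.X : PowerSeries ℚ) ^ k) Z

/-- The formal sum `Z(t)/1 + Z(t²)/2 + Z(t³)/3 + ⋯` for `Z` with zero constant coefficient; then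
only the terms with index `k ≤ n` contribute to the coefficient of `tⁿ`. -/
noncomputable def polyaSum (Z : PowerSeries ℚ) : PowerSeries ℚ :=
  PowerSeries.mk fun n =>
    ∑ k ∈ Finset.Icc 1 n, PowerSeries.coeff n (dilate k Z) / (k : ℚ)

/-- `M(Z) = exp(Z(t)/1 + Z(t²)/2 + Z(t³)/3 + ⋯)`, for `Z` with zero constant coefficient. -/
noncomputable def msetM (Z : PowerSeries ℚ) : PowerSeries ℚ :=
  PowerSeries.subst (polyaSum Z) (PowerSeries.exp ℚ)

/-- `M_{≥ 2}(Z) = M(Z) - 1 - Z(t)`. -/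
noncomputable def msetM2 (Z : PowerSeries ℚ) : PowerSeries ℚ :=
  msetM Z - 1 - Z

/-- `M_{≥ 3}(Z) = M(Z) - 1 - Z(t) - (Z(t)² + Z(t²)) / 2`. -/
noncomputable def msetM3 (Z : PowerSeries ℚ) : PowerSeries ℚ :=
  msetM Z - 1 - Z - PowerSeries.C (1 / 2 : ℚ) * (Z ^ 2 + dilate 2 Z)

/-! ### The non-plane trees and their codes -/

-- Give a structure in `𝒜` the code `(S, m)`: `S` is the multiset of its topmost subtrees in `ℬ`,
-- and `m` counts the nodes above them, `△_j` counting as `j`. The code determines the structure,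
-- and the codes are exactly the nonzero pairs with `|S| ≤ m + 1`.
--
-- Every atom gets a tree (`rootTree`). An arch over at least three atoms is a `ℬ`-node whose
-- children are their trees; an arch over at most two atoms adds one node to the sum of their codes.
-- Rotation relates systems of at most two atoms and preserves the total code. Hence `forestInv`,
-- the forest if there are at least three atoms and the total code otherwise, is constant on cohorts
-- (`ArchSim.forestInv_eq`).
--
-- It is also complete (`ArchSim.of_forestInv_eq`), by induction on size. Equal forests are matched
-- atom by atom. With at most two atoms, `|S| ≤ m + 2`. If `|S| ≤ m + 1`, rotations merge everything
-- into one atom or nothing; if `|S| = m + 2`, they isolate any chosen member of `S` as an atom.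
-- Either way only smaller interiors remain to be compared. Every tree occurs
-- (`exists_rootTree_trees_eq`), so atomic cohorts correspond to `𝒜`.
--
-- For the series, `M` counts multisets because both sides have the same logarithmic derivative
-- (`msetM_mk_card`). The factor `1/t` appears because `△_{k-1}` supplies one node fewer than a node
-- for each of its `k` children (`CombClass.sizeEquiv_mset_point_pair`).

theorem Finset.exists_perm_of_map_univ_eq {ι α : Type*} [Fintype ι] {f g : ι → α}
    (h : (Finset.univ.val.map f) = Finset.univ.val.map g) :
    ∃ σ : Equiv.Perm ι, ∀ i, f i = g (σ i) := by
  classical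
  have hc : ∀ c, Fintype.card {i // f i = c} = Fintype.card {i // g i = c} := by
    intro c
    have := congrArg (Multiset.count c) h
    rw [Multiset.count_map, Multiset.count_map] at this
    rw [Fintype.card_subtype, Fintype.card_subtype]
    simpa [Finset.card, Finset.filter, eq_comm] using this
  let e : ∀ c, {i // f i = c} ≃ {i // g i = c} := fun c => Fintype.equivOfCardEq (hc c)
  refine ⟨(Equiv.sigmaFiberEquiv f).symm.trans
    ((Equiv.sigmaCongrRight e).trans (Equiv.sigmaFiberEquiv g)), fun i => ?_⟩
  exact ((e (f i)) ⟨i, rfl⟩).2.symm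

theorem Finset.map_univ_eq_of_perm {ι α : Type*} [Fintype ι] {f g : ι → α}
    (σ : Equiv.Perm ι) (h : ∀ i, f i = g (σ i)) :
    (Finset.univ.val.map f) = Finset.univ.val.map g := by
  have : f = g ∘ σ := funext h
  rw [this, ← Multiset.map_map, Multiset.map_univ_val_equiv]

theorem Multiset.exists_map_univ_eq {α : Type*} (s : Multiset α) {k : ℕ} (h : s.card = k) :
    ∃ f : Fin k → α, Finset.univ.val.map f = s := by
  subst h
  obtain ⟨l, rfl⟩ := Quot.exists_rep s
  exact ⟨l.get, (Fin.univ_val_map l.get).trans (congrArg _ (List.ofFn_get l))⟩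

/-- The objects of `𝒜`. -/
abbrev TreeA : Type := Quotient isoASetoid

/-- The objects of `ℬ`. -/
abbrev TreeB : Type := Quotient isoBSetoid

def TreeA.size : TreeA → ℕ := classA.size

def TreeB.size : TreeB → ℕ := classB.size

/-- The multiset of the subtrees in `ℬ` closest to the root, and the number of nodes above them,
where `△_m` is counted as `m` nodes. -/
def PlaneA.code : PlaneA → Multiset TreeB × ℕ
  | .leaf => (0, 1)
  | .unary a => (a.code.1, a.code.2 + 1)
  | .tri k _ f => (Finset.univ.val.map fun i => (⟦f i⟧ : TreeB), k - 1)
  | .large b => ({⟦b⟧}, 0)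

/-- The children of the root. -/
def PlaneB.children : PlaneB → Multiset TreeA
  | .node _ _ f => Finset.univ.val.map fun i => ⟦f i⟧

theorem IsoA.code_eq : ∀ {a a' : PlaneA}, IsoA a a' → a.code = a'.code
  | _, _, .leaf => rfl
  | _, _, .unary h => by simp only [PlaneA.code, h.code_eq]
  | _, _, .tri σ h => Prod.ext (Finset.map_univ_eq_of_perm σ fun i => Quotient.sound (h i)) rfl
  | _, _, .large h => by simp only [PlaneA.code, Quotient.sound (s := isoBSetoid) h]

theorem IsoB.children_eq : ∀ {b b' : PlaneB}, IsoB b b' → b.children = b'.children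
  | _, _, .node σ h => Finset.map_univ_eq_of_perm σ fun i => Quotient.sound (h i)

theorem PlaneA.card_code_le : ∀ a : PlaneA, a.code.1.card ≤ a.code.2 + 1
  | .leaf => by simp [PlaneA.code]
  | .unary a => by have := a.card_code_le; simp only [PlaneA.code]; omega
  | .tri k hk f => by simp [PlaneA.code]; omega
  | .large b => by simp [PlaneA.code]

theorem PlaneA.code_ne_zero : ∀ a : PlaneA, a.code ≠ 0
  | .leaf => by simp [PlaneA.code]
  | .unary a => by simp [PlaneA.code]
  | .tri k hk f => by simp [PlaneA.code, Prod.ext_iff]; omega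
  | .large b => by simp [PlaneA.code, Prod.ext_iff]

/-- The code `(S, m)` reveals the root: `m = 0` only for `large`, `|S| = m + 1 ≥ 2` only for `tri`,
`(0, 1)` only for `leaf`, and `unary` covers the remaining pairs with `|S| ≤ m`. -/
theorem PlaneA.isoA_of_code_eq : ∀ a a' : PlaneA, a.code = a'.code → IsoA a a'
  | .leaf, .leaf, _ => .leaf
  | .unary a, .unary a', h => by
      simp only [PlaneA.code, Prod.mk.injEq, Nat.add_right_cancel_iff] at h
      exact .unary (isoA_of_code_eq a a' (Prod.ext h.1 h.2))
  | .tri k hk f, .tri k' hk' f', h => by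
      simp only [PlaneA.code, Prod.mk.injEq] at h
      obtain rfl : k = k' := by omega
      obtain ⟨σ, hσ⟩ := Finset.exists_perm_of_map_univ_eq h.1
      exact .tri σ fun i => Quotient.exact (hσ i)
  | .large b, .large b', h => by
      simp only [PlaneA.code, Prod.mk.injEq, and_true, Multiset.singleton_inj] at h
      exact .large (Quotient.exact h)
  | .leaf, .unary a, h | .unary a, .leaf, h => by
      have := a.code_ne_zero
      simp only [PlaneA.code, Prod.mk.injEq] at h
      exact absurd (Prod.ext (by simp [h]) (by simp; omega)) this
  | .leaf, .tri k hk f, h | .tri k hk f, .leaf, h => by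
      have := congrArg (fun x => x.1.card) h
      simp [PlaneA.code] at this
      omega
  | .leaf, .large b, h | .large b, .leaf, h => by simp [PlaneA.code] at h
  | .unary a, .tri k hk f, h | .tri k hk f, .unary a, h => by
      have h1 := congrArg (fun x => x.1.card) h
      have h2 := congrArg (fun x => x.2) h
      have h3 := a.card_code_le
      simp [PlaneA.code] at h1 h2
      omega
  | .unary a, .large b, h | .large b, .unary a, h => by simp [PlaneA.code] at h
  | .tri k hk f, .large b, h | .large b, .tri k hk f, h => by
      have h1 := congrArg (fun x => x.1.card) h
      simp [PlaneA.code] at h1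
      omega

/-- Unary nodes are peeled off while the bound on `|S|` is strict; once it is an equality, `tri` or
`large` realises the pair. The only pair with a strict bound that cannot be peeled is `(0, 1)`, the
leaf. -/
theorem PlaneA.exists_code_eq (S : Multiset TreeB) (m : ℕ) (h : S.card ≤ m + 1)
    (h0 : (S, m) ≠ 0) : ∃ a : PlaneA, a.code = (S, m) := by
  induction m with
  | zero =>
    have h1 : S.card = 1 := by
      have : S.card ≠ 0 := fun h => h0 (by simpa [Prod.ext_iff] using h)
      omega
    obtain ⟨b, rfl⟩ := Multiset.card_eq_one.1 h1
    obtain ⟨b, rfl⟩ := Quotient.exists_rep b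
    exact ⟨.large b, rfl⟩
  | succ m ih =>
    by_cases hm : (S, m) = 0
    · obtain ⟨rfl, rfl⟩ := Prod.ext_iff.1 hm
      exact ⟨.leaf, rfl⟩
    by_cases hS : S.card ≤ m + 1
    · obtain ⟨a, ha⟩ := ih hS hm
      exact ⟨.unary a, by simp [PlaneA.code, ha]⟩
    · obtain ⟨f, hf⟩ := S.exists_map_univ_eq (k := m + 2) (by omega)
      choose g hg using fun i => Quotient.exists_rep (f i)
      refine ⟨.tri (m + 2) (by omega) g, Prod.ext ?_ rfl⟩
      simpa only [PlaneA.code, hg] using hf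

theorem PlaneA.size_eq_code : ∀ a : PlaneA, a.size = a.code.2 + (a.code.1.map TreeB.size).sum
  | .leaf => by simp [PlaneA.code, PlaneA.size]
  | .unary a => by simp only [PlaneA.code, PlaneA.size, size_eq_code a]; omega
  | .tri k hk f => by
      simp only [PlaneA.code, PlaneA.size, Multiset.map_map]
      rfl
  | .large b => by
      simp only [PlaneA.code, PlaneA.size, Multiset.map_singleton, Multiset.sum_singleton, zero_add]
      rfl

theorem PlaneB.size_eq_children : ∀ b : PlaneB, b.size = 1 + (b.children.map TreeA.size).sum
  | .node k hk f => by
      simp only [PlaneB.children, PlaneB.size, Multiset.map_map]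
      rfl

theorem PlaneB.card_children : ∀ b : PlaneB, 3 ≤ b.children.card
  | .node k hk f => by simpa [PlaneB.children]

theorem PlaneB.isoB_of_children_eq : ∀ b b' : PlaneB, b.children = b'.children → IsoB b b'
  | .node k hk f, .node k' hk' f', h => by
      have := congrArg Multiset.card h
      simp only [PlaneB.children, Multiset.card_map, Finset.card_val, Finset.card_univ,
        Fintype.card_fin] at this
      subst this
      obtain ⟨σ, hσ⟩ := Finset.exists_perm_of_map_univ_eq
        (f := fun i => (⟦f i⟧ : TreeA)) (g := fun i => (⟦f' i⟧ : TreeA)) h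
      exact .node σ fun i => Quotient.exact (hσ i)

/-- The code of an object of `𝒜`, see `PlaneA.code`. -/
def TreeA.code : TreeA → Multiset TreeB × ℕ :=
  Quotient.lift PlaneA.code fun _ _ h => h.code_eq

/-- The children of the root. -/
def TreeB.children : TreeB → Multiset TreeA :=
  Quotient.lift PlaneB.children fun _ _ h => h.children_eq

theorem TreeA.code_injective : Function.Injective TreeA.code := by
  rintro ⟨a⟩ ⟨a'⟩ h
  exact Quotient.sound (PlaneA.isoA_of_code_eq a a' h)

theorem TreeA.card_code_le (a : TreeA) : a.code.1.card ≤ a.code.2 + 1 := by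
  obtain ⟨a, rfl⟩ := Quotient.exists_rep a
  exact a.card_code_le

theorem TreeA.code_ne_zero (a : TreeA) : a.code ≠ 0 := by
  obtain ⟨a, rfl⟩ := Quotient.exists_rep a
  exact a.code_ne_zero

theorem TreeA.exists_code_eq (x : Multiset TreeB × ℕ) (h : x.1.card ≤ x.2 + 1) (h0 : x ≠ 0) :
    ∃ a : TreeA, a.code = x :=
  let ⟨a, ha⟩ := PlaneA.exists_code_eq x.1 x.2 h h0
  ⟨⟦a⟧, ha⟩

theorem TreeA.size_eq (a : TreeA) : a.size = a.code.2 + (a.code.1.map TreeB.size).sum := by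
  obtain ⟨a, rfl⟩ := Quotient.exists_rep a
  exact a.size_eq_code

theorem TreeB.children_injective : Function.Injective TreeB.children := by
  rintro ⟨a⟩ ⟨a'⟩ h
  exact Quotient.sound (PlaneB.isoB_of_children_eq a a' h)

theorem TreeB.card_children (b : TreeB) : 3 ≤ b.children.card := by
  obtain ⟨b, rfl⟩ := Quotient.exists_rep b
  exact b.card_children

theorem TreeB.exists_children_eq (T : Multiset TreeA) (h : 3 ≤ T.card) :
    ∃ b : TreeB, b.children = T := by
  obtain ⟨f, hf⟩ := T.exists_map_univ_eq rfl
  choose g hg using fun i => Quotient.exists_rep (f i)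
  refine ⟨⟦.node _ h g⟧, ?_⟩
  change (Finset.univ.val.map fun i => (⟦g i⟧ : TreeA)) = T
  simpa only [hg] using hf

theorem TreeB.size_eq (b : TreeB) : b.size = 1 + (b.children.map TreeA.size).sum := by
  obtain ⟨b, rfl⟩ := Quotient.exists_rep b
  exact b.size_eq_children

theorem TreeB.size_pos (b : TreeB) : 0 < b.size := by
  rw [b.size_eq]; omega

theorem Multiset.le_sum_map_of_mem {α : Type*} (f : α → ℕ) {s : Multiset α} {a : α} (h : a ∈ s) :
    f a ≤ (s.map f).sum :=
  Multiset.single_le_sum (fun _ _ => Nat.zero_le _) _ (Multiset.mem_map_of_mem f h)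

theorem TreeA.size_pos (a : TreeA) : 0 < a.size := by
  rw [a.size_eq]
  rcases Nat.eq_zero_or_pos a.code.2 with h | h
  · obtain ⟨b, hb⟩ := Multiset.exists_mem_of_ne_zero
      (fun h' => a.code_ne_zero (Prod.ext h' h) : a.code.1 ≠ 0)
    have := Multiset.le_sum_map_of_mem TreeB.size hb
    have := b.size_pos
    omega
  · omega

-- The recursive specifications

theorem classB_sizeEquiv_specB : classB.SizeEquiv (specB classA) := by
  let f : TreeB → (specB classA).Obj := fun b => ((), ⟨b.children, b.card_children⟩)
  refine ⟨Equiv.ofBijective f ⟨fun b b' h => ?_, ?_⟩, fun b => (TreeB.size_eq b).symm⟩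
  · exact TreeB.children_injective (congrArg (fun x => x.2.1) h)
  · rintro ⟨⟨⟩, T, hT⟩
    obtain ⟨b, rfl⟩ := TreeB.exists_children_eq T hT
    exact ⟨b, rfl⟩

/-- The code of an object of the right-hand side of the specification of `𝒜`. -/
def specACode : (specA classA classB).Obj → Multiset TreeB × ℕ
  | .inl (.inl (.inl _)) => (0, 1)
  | .inl (.inl (.inr x)) => ((TreeA.code x.2).1, (TreeA.code x.2).2 + 1)
  | .inl (.inr x) => (x.2.2.1, x.1.1 - 1)
  | .inr b => ({b}, 0)

theorem specACode_injective : Function.Injective specACode := by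
  have h0 (a : TreeA) (h₁ : a.code.1 = 0) (h₂ : a.code.2 = 0) : False :=
    a.code_ne_zero (Prod.ext h₁ h₂)
  rintro (((⟨⟩ | ⟨⟨⟩, a⟩) | ⟨⟨k, hk⟩, ⟨⟩, S, hS⟩) | b)
    (((⟨⟩ | ⟨⟨⟩, a'⟩) | ⟨⟨k', hk'⟩, ⟨⟩, S', hS'⟩) | b') h
  all_goals
    obtain ⟨h₁, h₂⟩ := Prod.mk.inj h
    have h₃ := congrArg (Multiset.card (α := TreeB)) h₁
    clear h
    try dsimp only at h₁ h₂ h₃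
  all_goals try have hS₀ : Multiset.card (α := TreeB) S = k := hS
  all_goals try have hS₁ : Multiset.card (α := TreeB) S' = k' := hS'
  · rfl
  · exact (h0 a' h₁.symm (by omega)).elim
  · have := h₃.trans hS₁
    rw [Multiset.card_zero] at this
    omega
  · omega
  · exact (h0 a h₁ (by omega)).elim
  · have : a = a' := TreeA.code_injective (Prod.ext h₁ (Nat.add_right_cancel h₂))
    rw [this]
  · have := TreeA.card_code_le a
    have := h₃.trans hS₁
    omega
  · omega
  · have := h₃.symm.trans hS₀
    rw [Multiset.card_zero] at this
    omega
  · have := TreeA.card_code_le a'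
    have := h₃.symm.trans hS₀
    omega
  · obtain rfl : k = k' := by omega
    obtain rfl : S = S' := h₁
    rfl
  · have := (Multiset.card_singleton (α := TreeB) b').symm.trans (h₃.symm.trans hS₀)
    omega
  · omega
  · omega
  · have := (Multiset.card_singleton (α := TreeB) b).symm.trans (h₃.trans hS₁)
    omega
  · rw [Multiset.singleton_inj.1 h₁]

theorem card_specACode_le (x : (specA classA classB).Obj) :
    (specACode x).1.card ≤ (specACode x).2 + 1 := by
  obtain ((⟨⟩ | ⟨⟨⟩, a⟩) | ⟨⟨k, hk⟩, ⟨⟩, S, hS⟩) | b := x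
  · simp [specACode]
  · exact (TreeA.card_code_le a).trans (Nat.le_succ _)
  · change Multiset.card S = k at hS
    change Multiset.card S ≤ k - 1 + 1
    omega
  · exact (Multiset.card_singleton _).le

theorem specACode_ne_zero (x : (specA classA classB).Obj) : specACode x ≠ 0 := by
  obtain ((⟨⟩ | ⟨⟨⟩, a⟩) | ⟨⟨k, hk⟩, ⟨⟩, S, hS⟩) | b := x
  · simp [specACode]
  · simp [specACode]
  · intro h
    have : k - 1 = 0 := congrArg Prod.snd h
    omega
  · exact fun h => Multiset.singleton_ne_zero _ (congrArg Prod.fst h)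

theorem exists_specACode_eq (x : Multiset TreeB × ℕ) (h : x.1.card ≤ x.2 + 1) (h0 : x ≠ 0) :
    ∃ y, specACode y = x := by
  obtain ⟨S, m⟩ := x
  dsimp only at h
  rcases Nat.lt_or_ge m 1 with hm | hm
  · obtain rfl : m = 0 := by omega
    have h1 : S.card = 1 := by
      have : S.card ≠ 0 := fun h => h0 (by simpa [Prod.ext_iff] using h)
      omega
    obtain ⟨b, rfl⟩ := Multiset.card_eq_one.1 h1
    exact ⟨.inr b, rfl⟩
  · obtain ⟨m, rfl⟩ := Nat.exists_eq_add_of_le' hm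
    by_cases hm : (S, m) = 0
    · obtain ⟨rfl, rfl⟩ := Prod.ext_iff.1 hm
      exact ⟨.inl (.inl (.inl ())), rfl⟩
    by_cases hS : S.card ≤ m + 1
    · obtain ⟨a, ha⟩ := TreeA.exists_code_eq (S, m) hS hm
      exact ⟨.inl (.inl (.inr ((), a))), by simp [specACode, ha]⟩
    · have hS' : S.card = m + 2 := by omega
      exact ⟨.inl (.inr ⟨⟨m + 2, by omega⟩, (), S, hS'⟩), rfl⟩

theorem size_eq_specACode (x : (specA classA classB).Obj) :
    (specA classA classB).size x =
      (specACode x).2 + ((specACode x).1.map TreeB.size).sum := by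
  obtain ((⟨⟩ | ⟨⟨⟩, a⟩) | ⟨⟨k, hk⟩, ⟨⟩, S, hS⟩) | b := x
  · rfl
  · have := TreeA.size_eq a
    change 1 + TreeA.size a = (TreeA.code a).2 + 1 + ((TreeA.code a).1.map TreeB.size).sum
    omega
  · rfl
  · exact ((zero_add _).trans (Multiset.sum_singleton _)).symm

/-- Both sides are in bijection with the same set of codes, and on both sides the size is read off
the code. -/
theorem classA_sizeEquiv_specA : classA.SizeEquiv (specA classA classB) := by
  choose f hf using fun a : TreeA => exists_specACode_eq a.code a.card_code_le a.code_ne_zero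
  refine ⟨Equiv.ofBijective f ⟨fun a a' h => ?_, fun x => ?_⟩, fun a => ?_⟩
  · exact TreeA.code_injective ((hf a).symm.trans ((congrArg specACode h).trans (hf a')))
  · obtain ⟨a, ha⟩ := TreeA.exists_code_eq _ (card_specACode_le x) (specACode_ne_zero x)
    exact ⟨a, specACode_injective ((hf a).trans ha)⟩
  · have h := size_eq_specACode (f a)
    rw [hf a] at h
    exact h.trans (TreeA.size_eq a).symm

/-! ### The tree of an atom -/

/-- The sum of the codes of the trees in a forest. -/
def forestCode (T : Multiset TreeA) : Multiset TreeB × ℕ := (T.map TreeA.code).sum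

@[simp] theorem forestCode_zero : forestCode 0 = 0 := by simp [forestCode]

@[simp] theorem forestCode_singleton (a : TreeA) : forestCode {a} = a.code := by
  simp [forestCode]

@[simp] theorem forestCode_add (T T' : Multiset TreeA) :
    forestCode (T + T') = forestCode T + forestCode T' := by simp [forestCode]

/-- Each tree contributes at most one to the excess `|S| - m`. For two trees the excess is at most
two, so one more node makes the sum a valid code. -/
theorem card_forestCode_le (T : Multiset TreeA) :
    (forestCode T).1.card ≤ (forestCode T).2 + T.card := by
  induction T using Multiset.induction with
  | empty => simp
  | cons a T ih =>
    have := a.card_code_le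
    rw [← Multiset.singleton_add, forestCode_add, forestCode_singleton]
    simp only [Prod.fst_add, Prod.snd_add, Multiset.card_add, Multiset.card_singleton]
    omega

theorem sum_size_eq_forestCode (T : Multiset TreeA) :
    (T.map TreeA.size).sum =
      (forestCode T).2 + ((forestCode T).1.map TreeB.size).sum := by
  induction T using Multiset.induction with
  | empty => simp
  | cons a T ih =>
    have := a.size_eq
    rw [← Multiset.singleton_add, forestCode_add, forestCode_singleton]
    simp only [Prod.fst_add, Prod.snd_add, Multiset.map_add, Multiset.sum_add,
      Multiset.map_singleton, Multiset.sum_singleton]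
    omega

/-- The complete invariant of a cohort, in terms of the trees of its atoms. -/
def forestInv (T : Multiset TreeA) : Multiset TreeA ⊕ (Multiset TreeB × ℕ) :=
  if 3 ≤ T.card then .inl T else .inr (forestCode T)

theorem forestInv_eq_iff {T T' : Multiset TreeA} :
    forestInv T = forestInv T' ↔
      T = T' ∨ (T.card ≤ 2 ∧ T'.card ≤ 2 ∧ forestCode T = forestCode T') := by
  constructor
  · intro h
    unfold forestInv at h
    split_ifs at h with h₁ h₂ h₂
    · exact .inl (Sum.inl_injective h)
    · exact .inr ⟨by omega, by omega, Sum.inr_injective h⟩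
  · rintro (rfl | ⟨h₁, h₂, h⟩)
    · rfl
    · simp [forestInv, h, show ¬ 3 ≤ T.card by omega, show ¬ 3 ≤ T'.card by omega]

/-- Codes of trees are injective and never zero. This makes substitution of atoms harmless inside a
larger system. -/
theorem eq_of_forestCode_eq {T T' : Multiset TreeA} (hT : T.card ≤ 1) (hT' : T'.card ≤ 1)
    (h : forestCode T = forestCode T') : T = T' := by
  have key : ∀ S : Multiset TreeA, S.card ≤ 1 → S = 0 ∨ ∃ a, S = {a} := by
    intro S hS
    rcases Nat.le_one_iff_eq_zero_or_eq_one.1 hS with h | h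
    · exact .inl (Multiset.card_eq_zero.1 h)
    · exact .inr (Multiset.card_eq_one.1 h)
  obtain rfl | ⟨a, rfl⟩ := key T hT <;> obtain rfl | ⟨a', rfl⟩ := key T' hT'
  · rfl
  · exact (a'.code_ne_zero (by simpa using h.symm)).elim
  · exact (a.code_ne_zero (by simpa using h)).elim
  · rw [TreeA.code_injective (a₁ := a) (a₂ := a') (by simpa using h)]

theorem exists_rootTree (T : Multiset TreeA) :
    ∃ a : TreeA, (3 ≤ T.card → ∃ b : TreeB, b.children = T ∧ a.code = ({b}, 0)) ∧
      (T.card ≤ 2 → a.code = forestCode T + (0, 1)) := by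
  by_cases hT : 3 ≤ T.card
  · obtain ⟨b, hb⟩ := TreeB.exists_children_eq T hT
    obtain ⟨a, ha⟩ := TreeA.exists_code_eq ({b}, 0) (by simp) (by simp)
    exact ⟨a, fun _ => ⟨b, hb, ha⟩, fun h => by omega⟩
  · have h := card_forestCode_le T
    obtain ⟨a, ha⟩ := TreeA.exists_code_eq (forestCode T + (0, 1)) (by simp; omega)
      (fun h => by simpa using congrArg Prod.snd h)
    exact ⟨a, fun h => (hT h).elim, fun _ => ha⟩

/-- The tree of `A.nest`, where `T` consists of the trees of the atoms of `A`. -/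
noncomputable def rootTree (T : Multiset TreeA) : TreeA := (exists_rootTree T).choose

theorem code_rootTree_of_three_le {T : Multiset TreeA} (h : 3 ≤ T.card) :
    ∃ b : TreeB, b.children = T ∧ (rootTree T).code = ({b}, 0) :=
  (exists_rootTree T).choose_spec.1 h

theorem code_rootTree {T : Multiset TreeA} (h : T.card ≤ 2) :
    (rootTree T).code = forestCode T + (0, 1) :=
  (exists_rootTree T).choose_spec.2 h

/-- The two regimes cannot collide: the node count of the code is zero over three or more trees and
positive over at most two. -/
theorem rootTree_eq_iff {T T' : Multiset TreeA} :
    rootTree T = rootTree T' ↔ forestInv T = forestInv T' := by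
  rw [forestInv_eq_iff]
  constructor
  · intro h
    have hc := congrArg TreeA.code h
    rcases Nat.lt_or_ge T.card 3 with h₁ | h₁ <;> rcases Nat.lt_or_ge T'.card 3 with h₂ | h₂
    · rw [code_rootTree (by omega), code_rootTree (by omega)] at hc
      exact .inr ⟨by omega, by omega, add_right_cancel hc⟩
    · obtain ⟨b, rfl, hb⟩ := code_rootTree_of_three_le h₂
      rw [code_rootTree (by omega), hb] at hc
      simpa using congrArg Prod.snd hc
    · obtain ⟨b, rfl, hb⟩ := code_rootTree_of_three_le h₁
      rw [hb, code_rootTree (by omega)] at hc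
      simpa using congrArg Prod.snd hc
    · obtain ⟨b, rfl, hb⟩ := code_rootTree_of_three_le h₁
      obtain ⟨b', rfl, hb'⟩ := code_rootTree_of_three_le h₂
      rw [hb, hb'] at hc
      rw [Multiset.singleton_inj.1 (congrArg Prod.fst hc)]
      exact .inl rfl
  · rintro (rfl | ⟨h₁, h₂, h⟩)
    · rfl
    · exact TreeA.code_injective (by rw [code_rootTree h₁, code_rootTree h₂, h])

theorem size_rootTree (T : Multiset TreeA) :
    (rootTree T).size = (T.map TreeA.size).sum + 1 := by
  rw [TreeA.size_eq]
  rcases Nat.lt_or_ge T.card 3 with h | h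
  · rw [code_rootTree (by omega), sum_size_eq_forestCode]
    rw [Prod.fst_add, Prod.snd_add, add_zero]
    omega
  · obtain ⟨b, hT, hb⟩ := code_rootTree_of_three_le h
    rw [hb, ← hT]
    simp [b.size_eq, add_comm]

/-! ### The forest of an arch system -/

namespace DyckWord

theorem nest_add_induction {P : DyckWord → Prop} (zero : P 0)
    (nest_add : ∀ p q, P p → P q → P (p.nest + q)) (w : DyckWord) : P w := by
  by_cases h : w = 0
  · exact h ▸ zero
  · rw [← nest_insidePart_add_outsidePart h]
    have := semilength_insidePart_lt h
    have := semilength_outsidePart_lt h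
    exact nest_add _ _ (nest_add_induction zero nest_add _) (nest_add_induction zero nest_add _)
termination_by w.semilength

/-- The trees of the atoms of an arch system. -/
noncomputable def trees (w : DyckWord) : Multiset TreeA :=
  if h : w = 0 then 0 else
    have := semilength_insidePart_lt h
    have := semilength_outsidePart_lt h
    rootTree w.insidePart.trees ::ₘ w.outsidePart.trees
termination_by w.semilength

@[simp] theorem trees_zero : trees 0 = 0 := by rw [trees]; simp

theorem trees_nest_add (p q : DyckWord) :
    (p.nest + q).trees = rootTree p.trees ::ₘ q.trees := by
  rw [trees]
  simp

@[simp] theorem trees_nest (p : DyckWord) : p.nest.trees = {rootTree p.trees} := by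
  simpa using trees_nest_add p 0

@[simp] theorem trees_add (p q : DyckWord) : (p + q).trees = p.trees + q.trees := by
  induction p using nest_add_induction with
  | zero => simp
  | nest_add p r _ ih => rw [add_assoc, trees_nest_add, trees_nest_add, ih, Multiset.cons_add]

theorem trees_eq_zero {p : DyckWord} : p.trees = 0 ↔ p = 0 := by
  induction p using nest_add_induction with
  | zero => simp
  | nest_add p q _ _ => simp

theorem sum_size_trees (p : DyckWord) : (p.trees.map TreeA.size).sum = p.semilength := by
  induction p using nest_add_induction with
  | zero => simp
  | nest_add p q hp hq => simp [size_rootTree, hp, hq]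

theorem size_rootTree_trees (p : DyckWord) : (rootTree p.trees).size = p.nest.semilength := by
  rw [size_rootTree, sum_size_trees, semilength_nest]

theorem exists_of_mem_trees {x : TreeA} {w : DyckWord} (h : x ∈ w.trees) :
    ∃ P p Q, w = P + nest p + Q ∧ rootTree p.trees = x := by
  induction w using nest_add_induction with
  | zero => simp at h
  | nest_add p q _ ih =>
    rw [trees_nest_add, Multiset.mem_cons] at h
    rcases h with rfl | h
    · exact ⟨0, p, q, by simp, rfl⟩
    · obtain ⟨P, p', Q, rfl, hx⟩ := ih h
      exact ⟨p.nest + P, p', Q, by simp only [add_assoc], hx⟩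

theorem exists_of_card_trees_le_two {w : DyckWord} (h : w.trees.card ≤ 2) :
    w = 0 ∨ (∃ p, w = nest p) ∨ ∃ p q, w = nest p + nest q := by
  by_cases h₀ : w = 0
  · exact .inl h₀
  refine .inr ?_
  rw [← nest_insidePart_add_outsidePart h₀] at h ⊢
  by_cases h₁ : w.outsidePart = 0
  · exact .inl ⟨_, by rw [h₁, add_zero]⟩
  rw [← nest_insidePart_add_outsidePart h₁] at h ⊢
  by_cases h₂ : w.outsidePart.outsidePart = 0
  · exact .inr ⟨_, _, by rw [h₂, add_zero]⟩
  rw [← nest_insidePart_add_outsidePart h₂] at h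
  simp at h

theorem isAtomArch_iff {a : DyckWord} : IsAtomArch a ↔ ∃ p, a = nest p := by
  constructor
  · rintro ⟨h₀, h⟩
    have := (h _ _ (nest_insidePart_add_outsidePart h₀).symm).resolve_left nest_ne_zero
    refine ⟨a.insidePart, ?_⟩
    conv_lhs => rw [← nest_insidePart_add_outsidePart h₀, this, add_zero]
  · rintro ⟨p, rfl⟩
    refine ⟨nest_ne_zero, fun x y h => or_iff_not_imp_left.2 fun hx => ?_⟩
    have h₁ := congrArg (fun w => w.outsidePart) h
    rw [outsidePart_nest, outsidePart_add hx] at h₁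
    exact (add_eq_zero'.1 h₁.symm).2

theorem isAtomOrEmpty_iff {a : DyckWord} : IsAtomOrEmpty a ↔ a = 0 ∨ ∃ p, a = nest p := by
  rw [IsAtomOrEmpty, isAtomArch_iff]

theorem isAtomOrEmpty_nest (p : DyckWord) : IsAtomOrEmpty p.nest :=
  isAtomOrEmpty_iff.2 (.inr ⟨p, rfl⟩)

theorem isAtomOrEmpty_zero : IsAtomOrEmpty 0 := .inl rfl

theorem card_trees_le_one {a : DyckWord} (h : IsAtomOrEmpty a) : a.trees.card ≤ 1 := by
  obtain rfl | ⟨p, rfl⟩ := isAtomOrEmpty_iff.1 h <;> simp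

end DyckWord

-- The forest invariant is complete

open DyckWord in
theorem ArchSim.forestInv_eq {A B : DyckWord} (h : ArchSim A B) :
    forestInv A.trees = forestInv B.trees := by
  induction h with
  | refl A => rfl
  | symm _ ih => exact ih.symm
  | trans _ _ ih₁ ih₂ => exact ih₁.trans ih₂
  | arch _ ih => rw [trees_nest, trees_nest, rootTree_eq_iff.2 ih]
  | subst P Q ha hb _ ih =>
    have := card_trees_le_one ha
    have := card_trees_le_one hb
    rcases forestInv_eq_iff.1 ih with h | ⟨-, -, h⟩
    · simp [h]
    · simp [eq_of_forestCode_eq (card_trees_le_one ha) (card_trees_le_one hb) h]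
  | comm P Q _ _ => simp only [trees_add, add_right_comm]
  | rotate ha hb hc =>
    have ha := card_trees_le_one ha
    have hb := card_trees_le_one hb
    have hc := card_trees_le_one hc
    -- Each of `a`, `b`, `c` has at most one tree, so every group has at most two and both total
    -- codes are the sum of the three codes plus one node.
    refine forestInv_eq_iff.2 (.inr ⟨by simp; omega, by simp; omega, ?_⟩)
    simp only [trees_add, trees_nest, forestCode_add, forestCode_singleton]
    rw [code_rootTree (by simp; omega), code_rootTree (by simp; omega)]
    simp only [forestCode_add]
    abel

namespace ArchSim
open DyckWord

theorem swap {a b : DyckWord} (ha : IsAtomOrEmpty a) (hb : IsAtomOrEmpty b) :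
    ArchSim (a + b) (b + a) := by
  simpa using comm 0 0 ha hb

theorem nest_add_nest {p p' q q' : DyckWord} (hp : ArchSim p p') (hq : ArchSim q q') :
    ArchSim (p.nest + q.nest) (p'.nest + q'.nest) := by
  have h₁ := subst 0 q.nest (isAtomOrEmpty_nest p) (isAtomOrEmpty_nest p') hp.arch
  have h₂ := subst p'.nest 0 (isAtomOrEmpty_nest q) (isAtomOrEmpty_nest q') hq.arch
  simp only [zero_add, add_zero] at h₁ h₂
  exact h₁.trans h₂

/-- The prefix `R` absorbs the atoms already passed. It has to be carried along because `∼` is not a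
congruence for concatenation. -/
theorem add_nest_add (R P p Q : DyckWord) :
    ArchSim (R + (P + p.nest + Q)) (R + (p.nest + (P + Q))) := by
  induction P using nest_add_induction generalizing R with
  | zero => simpa using refl _
  | nest_add r P _ ih =>
    have h₁ := ih (R + r.nest)
    have h₂ := comm R (P + Q) (isAtomOrEmpty_nest r) (isAtomOrEmpty_nest p)
    simp only [add_assoc] at h₁ h₂ ⊢
    exact h₁.trans h₂

/-- The first atom of `A` has the same tree as some atom of `B`. Their interiors have equal
invariants, hence are equivalent by `ih`; the atom of `B` is commuted to the front and the pair
moves into `R`. -/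
theorem of_trees_eq {n : ℕ}
    (ih : ∀ p q : DyckWord, p.semilength < n → forestInv p.trees = forestInv q.trees → ArchSim p q)
    (A B R : DyckWord) (hA : A.semilength ≤ n) (h : A.trees = B.trees) :
    ArchSim (R + A) (R + B) := by
  induction A using nest_add_induction generalizing B R with
  | zero =>
    rw [trees_zero, eq_comm, trees_eq_zero] at h
    exact h ▸ refl _
  | nest_add p q _ ihq =>
    simp only [semilength_add, semilength_nest] at hA
    rw [trees_nest_add] at h
    obtain ⟨P, p', Q, rfl, hp⟩ := exists_of_mem_trees (h ▸ Multiset.mem_cons_self _ _)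
    have hpp := ih p p' (by omega) (rootTree_eq_iff.1 hp.symm)
    have hq : q.trees = (P + Q).trees := by
      rw [trees_add, trees_add, trees_nest, hp, add_right_comm, add_comm (_ + _),
        Multiset.singleton_add, Multiset.cons_inj_right] at h
      rw [h, trees_add]
    have h₁ := ihq (P + Q) (R + p.nest) (by omega) hq
    have h₂ := subst R (P + Q) (isAtomOrEmpty_nest p) (isAtomOrEmpty_nest p') hpp.arch
    have h₃ := (add_nest_add R P p' Q).symm
    simp only [add_assoc] at h₁ h₂ h₃ ⊢
    exact h₁.trans (h₂.trans h₃)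

/-- An arch system with at most two atoms is equivalent to an atom unless its code has too few
nodes. -/
theorem exists_isAtomOrEmpty (A : DyckWord) (hA : A.trees.card ≤ 2)
    (h : (forestCode A.trees).1.card ≤ (forestCode A.trees).2 + 1) :
    ∃ a, IsAtomOrEmpty a ∧ ArchSim A a := by
  induction hn : A.semilength using Nat.strong_induction_on generalizing A with
  | h n ih =>
  -- The hypothesis `|S| ≤ m` rules out three atoms in `p`. Removing the outer node leaves `|S| ≤ m
  -- + 1` for `p` itself, so by induction `p` reduces to an atom or nothing.
  have key : ∀ p q : DyckWord, p.semilength < n →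
      (rootTree p.trees).code.1.card ≤ (rootTree p.trees).code.2 →
      ∃ a, IsAtomOrEmpty a ∧ ArchSim (p.nest + q.nest) a := by
    intro p q hp hc
    have hcard : p.trees.card ≤ 2 := by
      by_contra hcard
      obtain ⟨b, -, hb⟩ := code_rootTree_of_three_le (show 3 ≤ p.trees.card by omega)
      simp [hb] at hc
    rw [code_rootTree hcard] at hc
    obtain ⟨a, ha, hpa⟩ := ih _ hp p hcard (by simpa using hc) rfl
    refine ⟨(a + q.nest).nest, isAtomOrEmpty_nest _, (nest_add_nest hpa (refl q)).trans ?_⟩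
    -- Rotation with empty first entry moves the second atom under the arch of the first.
    simpa using (rotate isAtomOrEmpty_zero ha (isAtomOrEmpty_nest q)).symm
  obtain rfl | ⟨p, rfl⟩ | ⟨p, q, rfl⟩ := exists_of_card_trees_le_two hA
  · exact ⟨0, isAtomOrEmpty_zero, refl _⟩
  · exact ⟨_, isAtomOrEmpty_nest p, refl _⟩
  · simp only [semilength_add, semilength_nest] at hn
    simp only [trees_add, trees_nest, forestCode_add, forestCode_singleton, Prod.fst_add,
      Prod.snd_add, Multiset.card_add] at h
    -- The total excess is at most one, so one of the two atoms has excess at most zero.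
    rcases le_or_gt (rootTree p.trees).code.1.card (rootTree p.trees).code.2 with h' | h'
    · exact key p q (by omega) h'
    · obtain ⟨a, ha, hqa⟩ := key q p (by omega) (by omega)
      exact ⟨a, ha, (swap (isAtomOrEmpty_nest p) (isAtomOrEmpty_nest q)).trans hqa⟩

/-- In an arch system with two atoms that is not equivalent to an atom, any of the trees in `ℬ`
can be split off. -/
theorem exists_nest_add_nest (A : DyckWord) (hA : A.trees.card ≤ 2)
    (h : (forestCode A.trees).2 + 2 ≤ (forestCode A.trees).1.card) (b : TreeB)
    (hb : b ∈ (forestCode A.trees).1) :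
    ∃ p q : DyckWord, ArchSim A (p.nest + q.nest) ∧ (rootTree p.trees).code = ({b}, 0) := by
  induction hn : A.semilength using Nat.strong_induction_on generalizing A with
  | h n ih =>
  -- If `p` has at most two atoms, its own excess is two, so by induction `b` splits off inside `p`,
  -- and a rotation brings it outside. Otherwise the atom over `p` has code `({b}, 0)` already.
  have key : ∀ p q : DyckWord, p.semilength < n →
      (rootTree p.trees).code.2 + 1 ≤ (rootTree p.trees).code.1.card →
      b ∈ (rootTree p.trees).code.1 →
      ∃ p' q' : DyckWord, ArchSim (p.nest + q.nest) (p'.nest + q'.nest) ∧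
        (rootTree p'.trees).code = ({b}, 0) := by
    intro p q hp hc hb
    rcases Nat.lt_or_ge p.trees.card 3 with hcard | hcard
    · rw [code_rootTree (by omega)] at hc hb
      obtain ⟨p', q', hpq, hb'⟩ := ih _ hp p (by omega) (by simp at hc; omega)
        (by simpa using hb) rfl
      exact ⟨p', q'.nest + q.nest, (nest_add_nest hpq (refl q)).trans (rotate
        (isAtomOrEmpty_nest p') (isAtomOrEmpty_nest q') (isAtomOrEmpty_nest q)).symm, hb'⟩
    · obtain ⟨b', -, hb'⟩ := code_rootTree_of_three_le hcard
      rw [hb', Multiset.mem_singleton] at hb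
      exact ⟨p, q, refl _, hb ▸ hb'⟩
  -- Each atom has excess at most one and the total is at least two, so both have excess exactly one
  -- and `key` applies to whichever contains `b`.
  have hle (p : DyckWord) := (rootTree p.trees).card_code_le
  obtain rfl | ⟨p, rfl⟩ | ⟨p, q, rfl⟩ := exists_of_card_trees_le_two hA
  · simp at h
  · have := hle p
    simp only [trees_nest, forestCode_singleton] at h
    omega
  · have := hle p
    have := hle q
    simp only [semilength_add, semilength_nest] at hn
    simp only [trees_add, trees_nest, forestCode_add, forestCode_singleton, Prod.fst_add,
      Prod.snd_add, Multiset.card_add, Multiset.mem_add] at h hb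
    rcases hb with hb | hb
    · exact key p q (by omega) (by omega) hb
    · obtain ⟨p', q', hpq, hb'⟩ := key q p (by omega) (by omega) hb
      exact ⟨p', q', (swap (isAtomOrEmpty_nest p) (isAtomOrEmpty_nest q)).trans hpq, hb'⟩

theorem of_forestInv_eq (A B : DyckWord) (h : forestInv A.trees = forestInv B.trees) :
    ArchSim A B := by
  induction hn : A.semilength using Nat.strong_induction_on generalizing A B with
  | h n ih =>
  have ih' : ∀ p q : DyckWord, p.semilength < n → forestInv p.trees = forestInv q.trees →
      ArchSim p q := fun p q hp hpq => ih _ hp p q hpq rfl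
  obtain h | ⟨hA, hB, hAB⟩ := forestInv_eq_iff.1 h
  · simpa using of_trees_eq ih' A B 0 hn.le h
  rcases Nat.lt_or_ge ((forestCode A.trees).2 + 1) (forestCode A.trees).1.card with hc | hc
  · obtain ⟨b, hb⟩ := Multiset.card_pos_iff_exists_mem.1 (Nat.zero_lt_of_lt hc)
    obtain ⟨p, q, hpq, hp⟩ := exists_nest_add_nest A hA hc b hb
    obtain ⟨p', q', hpq', hp'⟩ := exists_nest_add_nest B hB (hAB ▸ hc) b (hAB ▸ hb)
    have hpp : rootTree p.trees = rootTree p'.trees := TreeA.code_injective (hp.trans hp'.symm)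
    have hs := hpq.semilength_eq
    simp only [semilength_add, semilength_nest] at hs
    have hinv := (hpq.symm.forestInv_eq.trans h).trans hpq'.forestInv_eq
    have hqq : rootTree q.trees = rootTree q'.trees := by
      rcases forestInv_eq_iff.1 hinv with h | ⟨-, -, h⟩
      · simpa [hpp] using h
      · exact TreeA.code_injective (by
          simpa only [trees_add, trees_nest, forestCode_add, forestCode_singleton, hpp,
            add_right_inj] using h)
    exact hpq.trans ((nest_add_nest (ih' p p' (by omega) (rootTree_eq_iff.1 hpp))
      (ih' q q' (by omega) (rootTree_eq_iff.1 hqq))).trans hpq'.symm)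
  · obtain ⟨a, ha, hAa⟩ := exists_isAtomOrEmpty A hA hc
    obtain ⟨b, hb, hBb⟩ := exists_isAtomOrEmpty B hB (hAB ▸ hc)
    have hs := hAa.semilength_eq
    have hinv := (hAa.symm.forestInv_eq.trans h).trans hBb.forestInv_eq
    have hab : a.trees = b.trees := by
      rcases forestInv_eq_iff.1 hinv with h | ⟨-, -, h⟩
      · exact h
      · exact eq_of_forestCode_eq (card_trees_le_one ha) (card_trees_le_one hb) h
    refine hAa.trans (trans ?_ hBb.symm)
    obtain rfl | ⟨p, rfl⟩ := isAtomOrEmpty_iff.1 ha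
    · rw [trees_zero, eq_comm, trees_eq_zero] at hab
      exact hab ▸ refl _
    · obtain rfl | ⟨q, rfl⟩ := isAtomOrEmpty_iff.1 hb
      · simp at hab
      · rw [semilength_nest] at hs
        exact (ih' p q (by omega) (rootTree_eq_iff.1 (by simpa using hab))).arch

end ArchSim

-- Every tree is the tree of an atom

theorem exists_trees_eq (T : Multiset TreeA) (h : ∀ c ∈ T, ∃ p : DyckWord, rootTree p.trees = c) :
    ∃ w : DyckWord, w.trees = T := by
  induction T using Multiset.induction with
  | empty => exact ⟨0, DyckWord.trees_zero⟩
  | cons a T ih =>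
    obtain ⟨p, rfl⟩ := h a (Multiset.mem_cons_self _ _)
    obtain ⟨w, rfl⟩ := ih fun c hc => h c (Multiset.mem_cons_of_mem hc)
    exact ⟨p.nest + w, DyckWord.trees_nest_add p w⟩

theorem exists_rootTree_trees_eq (a : TreeA) : ∃ p : DyckWord, rootTree p.trees = a := by
  induction hn : a.size using Nat.strong_induction_on generalizing a with
  | h n ih =>
  rw [a.size_eq] at hn
  have hle := a.card_code_le
  obtain ⟨⟨S, m⟩, hx⟩ : ∃ x, a.code = x := ⟨_, rfl⟩
  rw [hx] at hn hle
  dsimp only at hn hle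
  obtain _ | m := m
  · have h1 : S.card = 1 := by
      have : S.card ≠ 0 := fun h =>
        a.code_ne_zero (hx.trans (by simpa [Prod.ext_iff] using h))
      omega
    obtain ⟨b, rfl⟩ := Multiset.card_eq_one.1 h1
    obtain ⟨w, hw⟩ := exists_trees_eq b.children fun c hc => by
      have := Multiset.le_sum_map_of_mem TreeA.size hc
      have := b.size_eq
      simp only [Multiset.map_singleton, Multiset.sum_singleton] at hn
      exact ih c.size (by omega) c rfl
    obtain ⟨b', hb', hc⟩ := code_rootTree_of_three_le (hw ▸ b.card_children)
    rw [hw] at hb'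
    rw [TreeB.children_injective hb', ← hx] at hc
    exact ⟨w, TreeA.code_injective hc⟩
  · suffices ∃ T : Multiset TreeA, T.card ≤ 2 ∧ forestCode T = (S, m) by
      obtain ⟨T, hT, hTm⟩ := this
      obtain ⟨w, rfl⟩ := exists_trees_eq T fun c hc => by
        have h := Multiset.le_sum_map_of_mem TreeA.size hc
        rw [sum_size_eq_forestCode, hTm] at h
        dsimp only at h
        exact ih c.size (by omega) c rfl
      exact ⟨w, TreeA.code_injective (by rw [code_rootTree hT, hTm, hx]; simp)⟩
    by_cases h0 : (S, m) = 0
    · exact ⟨0, by simp, by simp [h0]⟩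
    by_cases hS : S.card ≤ m + 1
    · obtain ⟨a', ha'⟩ := TreeA.exists_code_eq (S, m) hS h0
      exact ⟨{a'}, by simp, by simp [ha']⟩
    -- Here `|S| = m + 2` is too large for one tree; the code is split as `({b}, 0)` plus the rest,
    -- which meets the bound exactly.
    obtain ⟨b, hb⟩ := Multiset.card_pos_iff_exists_mem.1 (show 0 < S.card by omega)
    obtain ⟨S, rfl⟩ := Multiset.exists_cons_of_mem hb
    rw [Multiset.card_cons] at hS hle
    obtain ⟨a₁, ha₁⟩ := TreeA.exists_code_eq ({b}, 0) (by simp) (by simp)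
    obtain ⟨a₂, ha₂⟩ := TreeA.exists_code_eq (S, m) (by dsimp only; omega) (fun h => by
      have := congrArg (fun x => x.1.card) h
      simp at this
      simp [this] at hS)
    exact ⟨{a₁} + {a₂}, by simp, by
      rw [forestCode_add, forestCode_singleton, forestCode_singleton, ha₁, ha₂]
      simp⟩

theorem atomicCohorts_sizeEquiv_classA : atomicCohorts.SizeEquiv classA := by
  choose p hp using exists_rootTree_trees_eq
  let f : TreeA → {C : Cohort // C.IsAtomic} := fun a =>
    ⟨Cohort.mk (p a).nest, (p a).nest, DyckWord.isAtomArch_iff.2 ⟨_, rfl⟩, rfl⟩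
  have hf : Function.Bijective f := by
    constructor
    · intro a a' h
      have h₁ : ArchSim (p a).nest (p a').nest := Quotient.exact (congrArg Subtype.val h)
      rcases forestInv_eq_iff.1 h₁.forestInv_eq with h₂ | ⟨-, -, h₂⟩
      · simpa [hp] using h₂
      · exact TreeA.code_injective (by simpa [hp] using h₂)
    · rintro ⟨C, a, ha, rfl⟩
      obtain ⟨q, rfl⟩ := DyckWord.isAtomArch_iff.1 ha
      refine ⟨rootTree q.trees, Subtype.ext (Quotient.sound ?_)⟩
      exact (ArchSim.of_forestInv_eq _ _ (rootTree_eq_iff.1 (hp _))).arch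
  have hsize (a : TreeA) : (f a).1.size = a.size := by
    conv_rhs => rw [← hp a, DyckWord.size_rootTree_trees]
    rfl
  refine ⟨(Equiv.ofBijective f hf).symm, fun C => ?_⟩
  obtain ⟨a, rfl⟩ := hf.2 C
  have h : (Equiv.ofBijective f hf).symm (f a) = a := (Equiv.ofBijective f hf).symm_apply_apply a
  exact (congrArg TreeA.size h).trans (hsize a).symm

/-! ### Counting multisets -/

section CountMultisets

variable {α : Type*} {σ : α → ℕ}

theorem Multiset.card_le_sum_map (hσ : ∀ x, 0 < σ x) (s : Multiset α) :
    s.card ≤ (s.map σ).sum := by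
  induction s using Multiset.induction with
  | empty => simp
  | cons a s ih =>
    have := hσ a
    rw [Multiset.card_cons, Multiset.map_cons, Multiset.sum_cons]
    omega

theorem Set.finite_fiber_le (hf : ∀ n, {x | σ x = n}.Finite) (n : ℕ) : {x | σ x ≤ n}.Finite := by
  refine ((Set.finite_Iic n).biUnion fun i _ => hf i).subset fun x hx => ?_
  simp only [Set.mem_iUnion]
  exact ⟨σ x, hx, rfl⟩

theorem Multiset.finite_sum_map_eq (hσ : ∀ x, 0 < σ x) (hf : ∀ n, {x | σ x = n}.Finite) (n : ℕ) :
    {s : Multiset α | (s.map σ).sum = n}.Finite := by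
  classical
  -- Sizes are positive, so a multiset of total size `n` has at most `n` elements, each of size at
  -- most `n`.
  refine (Set.finite_Iic (n • (Set.finite_fiber_le hf n).toFinset.val)).subset ?_
  intro s hs
  rw [Set.mem_Iic, Multiset.le_iff_count]
  intro a
  rw [Multiset.count_nsmul]
  by_cases ha : a ∈ s
  · have h₁ := Multiset.le_sum_map_of_mem σ ha
    have h₂ := Multiset.card_le_sum_map hσ s
    have h₃ := Multiset.count_le_card a s
    rw [Set.mem_ofPred_eq] at hs
    rw [Multiset.count_eq_one_of_mem (Finset.nodup _) (by simpa using hs ▸ h₁)]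
    omega
  · simp [Multiset.count_eq_zero_of_notMem ha]

theorem Finset.sum_comp_eq_sum_card_mul {F : ℕ → Finset α} (hF : ∀ n x, x ∈ F n ↔ σ x = n)
    {X : Finset α} {n : ℕ} (hX : ∀ x, x ∈ X ↔ σ x ≤ n) (g : ℕ → ℕ) :
    ∑ x ∈ X, g (σ x) = ∑ d ∈ Finset.range (n + 1), (F d).card * g d := by
  rw [← Finset.sum_fiberwise_of_maps_to (g := σ) (t := Finset.range (n + 1))
    (fun x hx => Finset.mem_range.2 (Nat.lt_succ_of_le ((hX x).1 hx)))]
  refine Finset.sum_congr rfl fun d hd => ?_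
  have : X.filter (fun x => σ x = d) = F d := by
    ext x
    rw [Finset.mem_range] at hd
    rw [Finset.mem_filter, hX, hF]
    omega
  rw [this, ← smul_eq_mul, ← Finset.sum_const]
  exact Finset.sum_congr rfl fun x hx => by rw [(hF d x).1 hx]

variable [DecidableEq α]

/-- Layer-cake: a multiplicity is the number of levels `i ≥ 1` not exceeding it; then the sums are
exchanged. -/
theorem Multiset.sum_sum_map_eq (U : Finset (Multiset α)) (X : Finset α) (N : ℕ)
    (hX : ∀ s ∈ U, ∀ x ∈ s, x ∈ X) (hN : ∀ s ∈ U, ∀ x, s.count x ≤ N) (w : α → ℕ) :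
    ∑ s ∈ U, (s.map w).sum =
      ∑ x ∈ X, ∑ i ∈ Finset.Icc 1 N, w x * (U.filter fun s => i ≤ s.count x).card := by
  have h : ∀ s ∈ U, (s.map w).sum =
      ∑ x ∈ X, ∑ i ∈ Finset.Icc 1 N, w x * if i ≤ s.count x then 1 else 0 := by
    intro s hs
    rw [Finset.sum_multiset_map_count]
    have hsub : s.toFinset ⊆ X := fun x hx => hX s hs x (Multiset.mem_toFinset.1 hx)
    rw [Finset.sum_subset hsub fun x _ hx => by
      rw [Multiset.mem_toFinset] at hx
      simp [Multiset.count_eq_zero_of_notMem hx]]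
    refine Finset.sum_congr rfl fun x _ => ?_
    have hc : (Finset.Icc 1 N).filter (fun i => i ≤ s.count x) = Finset.Icc 1 (s.count x) := by
      ext i
      have := hN s hs x
      simp only [Finset.mem_filter, Finset.mem_Icc]
      omega
    rw [← Finset.mul_sum, ← Finset.card_filter, hc, Nat.card_Icc, smul_eq_mul,
      Nat.add_sub_cancel, mul_comm]
  rw [Finset.sum_congr rfl h, Finset.sum_comm]
  refine Finset.sum_congr rfl fun x _ => ?_
  rw [Finset.sum_comm]
  refine Finset.sum_congr rfl fun i _ => ?_
  rw [← Finset.mul_sum, Finset.card_filter]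

/-- Removing `i` copies of `x` is a bijection onto the multisets of the remaining size. -/
theorem Multiset.card_filter_le_count {U : ℕ → Finset (Multiset α)}
    (hU : ∀ n s, s ∈ U n ↔ (s.map σ).sum = n) (n i : ℕ) (x : α) :
    ((U n).filter fun s => i ≤ s.count x).card =
      if i * σ x ≤ n then (U (n - i * σ x)).card else 0 := by
  have hrep (s : Multiset α) : ((s + Multiset.replicate i x).map σ).sum =
      (s.map σ).sum + i * σ x := by simp
  split_ifs with h
  · refine Finset.card_nbij' (fun s => s - Multiset.replicate i x)
      (fun s => s + Multiset.replicate i x) ?_ ?_ ?_ ?_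
    · intro s hs
      simp only [Finset.coe_filter, Set.mem_ofPred_eq, hU] at hs
      have := hrep (s - Multiset.replicate i x)
      rw [tsub_add_cancel_of_le (Multiset.le_count_iff_replicate_le.1 hs.2), hs.1] at this
      simp only [Finset.mem_coe, hU]
      omega
    · intro s hs
      simp only [Finset.mem_coe, hU] at hs
      simp only [Finset.coe_filter, Set.mem_ofPred_eq, hU, hrep, hs]
      simp
      omega
    · intro s hs
      simp only [Finset.coe_filter, Set.mem_ofPred_eq] at hs
      exact tsub_add_cancel_of_le (Multiset.le_count_iff_replicate_le.1 hs.2)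
    · intro s _
      simp
  · rw [Finset.card_eq_zero, Finset.filter_eq_empty_iff]
    intro s hs hi
    have := hrep (s - Multiset.replicate i x)
    rw [tsub_add_cancel_of_le (Multiset.le_count_iff_replicate_le.1 hi), (hU n s).1 hs] at this
    omega

/-- Total size is counted twice: by multiset, and by element and level of multiplicity. This is the
coefficient form of the logarithmic derivative of `M`. -/
theorem Multiset.mul_card_eq (hσ : ∀ x, 0 < σ x) {F : ℕ → Finset α}
    (hF : ∀ n x, x ∈ F n ↔ σ x = n) {U : ℕ → Finset (Multiset α)}
    (hU : ∀ n s, s ∈ U n ↔ (s.map σ).sum = n) (n : ℕ) :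
    n * (U n).card = ∑ d ∈ Finset.range (n + 1), (F d).card * ∑ i ∈ Finset.Icc 1 n,
      d * if i * d ≤ n then (U (n - i * d)).card else 0 := by
  have hf : ∀ n, {x | σ x = n}.Finite := fun n =>
    (F n).finite_toSet.subset fun x hx => (hF n x).2 hx
  have hX : ∀ x, x ∈ (Set.finite_fiber_le hf n).toFinset ↔ σ x ≤ n := fun x => by simp
  rw [← Finset.sum_comp_eq_sum_card_mul hF hX fun d => ∑ i ∈ Finset.Icc 1 n,
      d * if i * d ≤ n then (U (n - i * d)).card else 0]
  have h₁ : n * (U n).card = ∑ s ∈ U n, (s.map σ).sum := by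
    rw [Finset.sum_congr rfl fun s hs => (hU n s).1 hs, Finset.sum_const, smul_eq_mul, mul_comm]
  rw [h₁, Multiset.sum_sum_map_eq (U n) _ n
    (fun s hs x hx => (hX x).2 ((hU n s).1 hs ▸ Multiset.le_sum_map_of_mem σ hx))
    (fun s hs x => (Multiset.count_le_card x s).trans
      ((hU n s).1 hs ▸ Multiset.card_le_sum_map hσ s))]
  simp only [Multiset.card_filter_le_count hU]

/-- Elements of two-element multisets are counted with multiplicity. For fixed `x`, level one counts
the pairs `{x, y}`, and level two only `{x, x}`. -/
theorem Multiset.two_mul_card_filter {F : ℕ → Finset α}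
    (hF : ∀ n x, x ∈ F n ↔ σ x = n) {U : ℕ → Finset (Multiset α)}
    (hU : ∀ n s, s ∈ U n ↔ (s.map σ).sum = n) (n : ℕ) :
    2 * ((U n).filter fun s => s.card = 2).card =
      ∑ d ∈ Finset.range (n + 1), (F d).card * ((F (n - d)).card + if 2 * d = n then 1 else 0) := by
  have hf : ∀ n, {x | σ x = n}.Finite := fun n =>
    (F n).finite_toSet.subset fun x hx => (hF n x).2 hx
  have hX : ∀ x, x ∈ (Set.finite_fiber_le hf n).toFinset ↔ σ x ≤ n := fun x => by simp
  rw [← Finset.sum_comp_eq_sum_card_mul hF hX fun d =>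
    (F (n - d)).card + if 2 * d = n then 1 else 0]
  have h₁ : 2 * ((U n).filter fun s => s.card = 2).card =
      ∑ s ∈ (U n).filter fun s => s.card = 2, (s.map fun _ => 1).sum := by
    rw [Finset.sum_congr rfl fun s hs => by
      rw [Multiset.map_const', Multiset.sum_replicate, smul_eq_mul, mul_one,
        (Finset.mem_filter.1 hs).2], Finset.sum_const, smul_eq_mul, mul_comm]
  rw [h₁, Multiset.sum_sum_map_eq ((U n).filter fun s => s.card = 2) _ 2
    (fun s hs x hx => (hX x).2
      ((hU n s).1 (Finset.mem_filter.1 hs).1 ▸ Multiset.le_sum_map_of_mem σ hx))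
    (fun s hs x => (Multiset.count_le_card x s).trans (Finset.mem_filter.1 hs).2.le)]
  refine Finset.sum_congr rfl fun x hx => ?_
  have h12 : Finset.Icc 1 2 = {1, 2} := rfl
  rw [h12, Finset.sum_pair (by norm_num), one_mul, one_mul, Finset.filter_filter,
    Finset.filter_filter]
  have hx := (hX x).1 hx
  congr 1
  · refine (Finset.card_bij (fun y _ => {x, y}) ?_ ?_ ?_).symm
    · intro y hy
      have := (hF _ y).1 hy
      simp [hU]
      omega
    · intro y _ y' _ h
      simpa using h
    · intro s hs
      simp only [Finset.mem_filter, hU, Multiset.one_le_count_iff_mem] at hs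
      obtain ⟨s, rfl⟩ := Multiset.exists_cons_of_mem hs.2.2
      obtain ⟨y, rfl⟩ : ∃ y, s = {y} := Multiset.card_eq_one.1 (by simpa using hs.2.1)
      refine ⟨y, ?_, rfl⟩
      rw [hF]
      have := hs.1
      simp at this
      omega
  · have : (U n).filter (fun s => s.card = 2 ∧ 2 ≤ s.count x) =
        if 2 * σ x = n then {Multiset.replicate 2 x} else ∅ := by
      ext s
      have key : s.card = 2 ∧ 2 ≤ s.count x ↔ s = Multiset.replicate 2 x := by
        constructor
        · rintro ⟨h₁, h₂⟩
          exact (Multiset.eq_of_le_of_card_le (Multiset.le_count_iff_replicate_le.1 h₂)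
            (by simp [h₁])).symm
        · rintro rfl
          simp
      rw [Finset.mem_filter, key, hU]
      split_ifs with h
      · rw [Finset.mem_singleton]
        exact ⟨fun h => h.2, by rintro rfl; simp; omega⟩
      · simp only [Finset.notMem_empty, iff_false]
        rintro ⟨h', rfl⟩
        simp at h'
        omega
    rw [this]
    split_ifs <;> simp

end CountMultisets

/-! ### The generating function of multisets -/

section Exponential

open PowerSeries

theorem PowerSeries.eq_of_derivative_eq_mul {F G P : PowerSeries ℚ}
    (hF : derivative ℚ F = P * F) (hG : derivative ℚ G = P * G)
    (h₀ : constantCoeff F = constantCoeff G) : F = G := by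
  ext n
  induction n using Nat.strong_induction_on with
  | h n ih =>
  obtain _ | n := n
  · simpa using h₀
  · have h₁ := congrArg (coeff n) hF
    have h₂ := congrArg (coeff n) hG
    rw [coeff_derivative, coeff_mul] at h₁ h₂
    have h₃ : coeff (n + 1) F * ((n : ℚ) + 1) = coeff (n + 1) G * ((n : ℚ) + 1) := by
      rw [h₁, h₂]
      refine Finset.sum_congr rfl fun x hx => ?_
      rw [ih x.2 (by have := Finset.HasAntidiagonal.mem_antidiagonal.1 hx; omega)]
    exact mul_right_cancel₀ (by positivity) h₃

theorem constantCoeff_polyaSum (Z : PowerSeries ℚ) : constantCoeff (polyaSum Z) = 0 := by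
  rw [← coeff_zero_eq_constantCoeff_apply, polyaSum, coeff_mk]
  simp

theorem derivative_msetM (Z : PowerSeries ℚ) :
    derivative ℚ (msetM Z) = derivative ℚ (polyaSum Z) * msetM Z := by
  rw [msetM, derivative_subst (HasSubst.of_constantCoeff_zero' (constantCoeff_polyaSum Z)),
    derivative_exp, mul_comm]

theorem constantCoeff_msetM (Z : PowerSeries ℚ) : constantCoeff (msetM Z) = 1 := by
  have hs := HasSubst.of_constantCoeff_zero' (constantCoeff_polyaSum Z)
  have h : msetM Z = subst (polyaSum Z) (exp ℚ - 1) + 1 := by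
    have h1 : subst (polyaSum Z) (1 : PowerSeries ℚ) = 1 := by
      rw [← coe_substAlgHom hs, map_one]
    rw [subst_sub hs, h1, msetM]
    ring
  have h2 : constantCoeff (subst (polyaSum Z) (exp ℚ - 1)) = 0 :=
    constantCoeff_subst_eq_zero (constantCoeff_polyaSum Z) _ (by simp)
  rw [h, map_add, h2]
  simp

theorem coeff_dilate {k : ℕ} (hk : k ≠ 0) (Z : PowerSeries ℚ) (n : ℕ) :
    coeff n (dilate k Z) = if k ∣ n then coeff (n / k) Z else 0 := by
  rw [dilate, coeff_subst_X_pow hk]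
  simp

/-- If `k * d = i + 1`, the factor `i + 1` from differentiation over the denominator `k` leaves `d`.
The ranges depend on `n` rather than `i` so that the sums can later be exchanged. -/
theorem coeff_derivative_polyaSum (Z : PowerSeries ℚ) {i n : ℕ} (hi : i ≤ n) :
    coeff i (derivative ℚ (polyaSum Z)) =
      ∑ d ∈ Finset.range (n + 2), ∑ k ∈ Finset.Icc 1 (n + 1),
        if k * d = i + 1 then d * coeff d Z else 0 := by
  rw [coeff_derivative, polyaSum, coeff_mk, Finset.sum_mul, Finset.sum_comm]
  have hsub : Finset.Icc 1 (i + 1) ⊆ Finset.Icc 1 (n + 1) :=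
    Finset.Icc_subset_Icc le_rfl (by omega)
  rw [← Finset.sum_subset hsub]
  · refine Finset.sum_congr rfl fun k hk => ?_
    obtain ⟨hk₁, hk₂⟩ := Finset.mem_Icc.1 hk
    rw [coeff_dilate (by omega)]
    split_ifs with hdvd
    · obtain ⟨d, hd⟩ := hdvd
      have hdk : (i + 1) / k = d := by rw [hd, Nat.mul_div_cancel_left _ (by omega)]
      have hdn : d ≤ i + 1 := hd ▸ Nat.le_mul_of_pos_left d (by omega)
      rw [Finset.sum_eq_single d, if_pos hd.symm, hdk]
      · have : ((i : ℚ) + 1) = k * d := by exact_mod_cast hd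
        rw [this]
        have : (k : ℚ) ≠ 0 := by positivity
        field_simp
      · intro e _ he
        rw [if_neg]
        intro h
        exact he (Nat.eq_of_mul_eq_mul_left (by omega) (h.trans hd))
      · intro h
        exact absurd (Finset.mem_range.2 (by omega)) h
    · rw [zero_div, zero_mul, eq_comm]
      refine Finset.sum_eq_zero fun d _ => if_neg fun h => hdvd ⟨d, h.symm⟩
  · intro k hk hk'
    refine Finset.sum_eq_zero fun d _ => if_neg fun h => hk' ?_
    rw [Finset.mem_Icc] at hk ⊢
    refine ⟨hk.1, h ▸ Nat.le_mul_of_pos_right k (Nat.pos_of_ne_zero ?_)⟩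
    rintro rfl
    simp at h

/-- Both series have constant term `1` and solve `F' = P * F` with `P` the derivative of `polyaSum`;
for the counting series this is `Multiset.mul_card_eq`. -/
theorem msetM_mk_card {α : Type*} {σ : α → ℕ} (hσ : ∀ x, 0 < σ x) {F : ℕ → Finset α}
    (hF : ∀ n x, x ∈ F n ↔ σ x = n) {U : ℕ → Finset (Multiset α)}
    (hU : ∀ n s, s ∈ U n ↔ (s.map σ).sum = n) :
    msetM (PowerSeries.mk fun n => ((F n).card : ℚ)) =
      PowerSeries.mk fun n => ((U n).card : ℚ) := by
  classical
  refine eq_of_derivative_eq_mul (derivative_msetM _) ?_ ?_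
  · ext n
    have h := congrArg (Nat.cast (R := ℚ)) (Multiset.mul_card_eq hσ hF hU (n + 1))
    rw [coeff_derivative, coeff_mk, coeff_mul]
    push_cast at h
    rw [mul_comm, h, Finset.Nat.sum_antidiagonal_eq_sum_range_succ_mk]
    have h' : ∀ i ∈ Finset.range n.succ,
        coeff i (derivative ℚ (polyaSum (PowerSeries.mk fun n => ((F n).card : ℚ)))) *
          coeff (n - i) (PowerSeries.mk fun n => ((U n).card : ℚ)) =
        ∑ d ∈ Finset.range (n + 2), ∑ k ∈ Finset.Icc 1 (n + 1),
          if k * d = i + 1 then (d * (F d).card) * ((U (n - i)).card : ℚ) else 0 := by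
      intro i hi
      rw [coeff_derivative_polyaSum _ (Nat.le_of_lt_succ (Finset.mem_range.1 hi)), coeff_mk,
        Finset.sum_mul]
      refine Finset.sum_congr rfl fun d _ => ?_
      rw [Finset.sum_mul]
      refine Finset.sum_congr rfl fun k _ => ?_
      rw [coeff_mk, ite_mul, zero_mul]
    rw [Finset.sum_congr rfl h', Finset.sum_comm]
    refine Finset.sum_congr rfl fun d _ => ?_
    rw [Finset.sum_comm, Finset.mul_sum]
    refine Finset.sum_congr rfl fun k hk => ?_
    rcases Nat.eq_zero_or_pos d with rfl | hd
    · simp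
    have hkd : 0 < k * d := Nat.mul_pos (Finset.mem_Icc.1 hk).1 hd
    split_ifs with hle
    · rw [Finset.sum_eq_single (k * d - 1), if_pos (by omega),
        show n - (k * d - 1) = n + 1 - k * d by omega]
      · ring
      · intro i _ hi
        exact if_neg (by omega)
      · intro hi
        exact absurd (Finset.mem_range.2 (by omega)) hi
    · rw [mul_zero, mul_zero, eq_comm]
      refine Finset.sum_eq_zero fun i hi => if_neg ?_
      have := Finset.mem_range.1 hi
      omega
  · have : U 0 = {0} := by
      ext s
      rw [hU, Finset.mem_singleton]
      constructor
      · intro h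
        have := Multiset.card_le_sum_map hσ s
        exact Multiset.card_eq_zero.1 (by omega)
      · rintro rfl
        simp
    rw [constantCoeff_msetM, ← coeff_zero_eq_constantCoeff_apply, coeff_mk, this]
    simp

end Exponential

/-! ### Generating functions of classes -/

namespace CombClass

open PowerSeries

variable {S T : CombClass}

theorem SizeEquiv.finiteFibers (h : S.SizeEquiv T) (hT : T.FiniteFibers) : S.FiniteFibers := by
  obtain ⟨e, he⟩ := h
  intro n
  refine ((hT n).preimage e.injective.injOn).subset fun x hx => ?_
  exact (he x).trans hx

theorem SizeEquiv.symm (h : S.SizeEquiv T) : T.SizeEquiv S := by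
  obtain ⟨e, he⟩ := h
  exact ⟨e.symm, fun x => by rw [← he, e.apply_symm_apply]⟩

theorem SizeEquiv.genFun_eq (h : S.SizeEquiv T) : S.genFun = T.genFun := by
  obtain ⟨e, he⟩ := h
  ext n
  rw [genFun, genFun, coeff_mk, coeff_mk, ← Set.ncard_image_of_injective _ e.injective]
  congr 2
  ext y
  constructor
  · rintro ⟨x, hx, rfl⟩
    exact (he x).trans hx
  · intro hy
    exact ⟨e.symm y, (he _).symm.trans (by rwa [e.apply_symm_apply]), e.apply_symm_apply y⟩

theorem FiniteFibers.of_injective (hT : T.FiniteFibers) (f : S.Obj → T.Obj)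
    (hf : Function.Injective f) (c : ℕ) (h : ∀ x, T.size (f x) = S.size x + c) :
    S.FiniteFibers := by
  intro n
  refine ((hT (n + c)).preimage hf.injOn).subset fun x (hx : S.size x = n) => ?_
  exact (h x).trans (by rw [hx])

theorem genFun_union (hS : S.FiniteFibers) (hT : T.FiniteFibers) :
    (S.union T).genFun = S.genFun + T.genFun := by
  ext n
  simp only [genFun, map_add, coeff_mk]
  rw [← Set.ncard_image_of_injective _ (Sum.inl_injective (α := S.Obj) (β := T.Obj)),
    ← Set.ncard_image_of_injective _ (Sum.inr_injective (α := S.Obj) (β := T.Obj)),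
    ← Nat.cast_add, ← Set.ncard_union_eq _ ((hS n).image _) ((hT n).image _)]
  · congr 2
    ext x
    constructor
    · rcases x with x | x
      · exact fun hx => .inl ⟨x, hx, rfl⟩
      · exact fun hx => .inr ⟨x, hx, rfl⟩
    · rintro (⟨x, hx, rfl⟩ | ⟨x, hx, rfl⟩) <;> exact hx
  · rw [Set.disjoint_left]
    rintro _ ⟨x, _, rfl⟩ ⟨y, _, h⟩
    cases h

theorem genFun_point_pair (m : ℕ) (S : CombClass) :
    ((point m).pair S).genFun = X ^ m * S.genFun := by
  ext n
  rw [coeff_X_pow_mul']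
  simp only [genFun, coeff_mk]
  split_ifs with h
  · congr 1
    rw [← Set.ncard_image_of_injective _ (Prod.mk_right_injective (β := S.Obj) ())]
    congr 1
    ext ⟨⟨⟩, x⟩
    constructor
    · intro (hx : m + S.size x = n)
      exact ⟨x, show S.size x = n - m by omega, rfl⟩
    · rintro ⟨y, hy, h'⟩
      obtain rfl : y = x := congrArg Prod.snd h'
      change S.size y = n - m at hy
      change m + S.size y = n
      omega
  · rw [Nat.cast_eq_zero]
    have : {x | ((point m).pair S).size x = n} = ∅ := by
      refine Set.eq_empty_of_forall_notMem ?_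
      intro ⟨_, x⟩ (hx : m + S.size x = n)
      omega
    rw [this, Set.ncard_empty]

theorem genFun_point (m : ℕ) : (point m).genFun = X ^ m := by
  ext n
  rw [coeff_X_pow, genFun, coeff_mk]
  split_ifs with h
  · subst h
    have : {x : (point n).Obj | (point n).size x = n}.ncard = 1 :=
      Set.ncard_eq_one.2 ⟨(), Set.eq_singleton_iff_unique_mem.2 ⟨rfl, fun _ _ => rfl⟩⟩
    rw [this, Nat.cast_one]
  · have : {x : (point m).Obj | (point m).size x = n} = ∅ :=
      Set.eq_empty_of_forall_notMem fun x (hx : m = n) => h hx.symm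
    rw [this, Set.ncard_empty, Nat.cast_zero]

theorem coeff_genFun_mset {U : ℕ → Finset (Multiset S.Obj)}
    (hU : ∀ n s, s ∈ U n ↔ (s.map S.size).sum = n) (p : ℕ → Prop) [DecidablePred p] (n : ℕ) :
    coeff n (mset p S).genFun = (((U n).filter fun s => p s.card).card : ℚ) := by
  rw [genFun, coeff_mk, ← Set.ncard_coe_finset,
    ← Set.ncard_image_of_injective {x | (mset p S).size x = n}
      (Subtype.val_injective (p := fun s : Multiset S.Obj => p s.card))]
  congr 2
  ext s
  simp only [Finset.coe_filter, Set.mem_ofPred_eq, hU]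
  constructor
  · rintro ⟨x, hx, rfl⟩
    exact ⟨hx, x.2⟩
  · rintro ⟨h, hs⟩
    exact ⟨⟨s, hs⟩, h, rfl⟩

/-- Polya's formulas for the number of multisets of objects of positive size. -/
theorem genFun_mset (hS : S.FiniteFibers) (hpos : ∀ x, 0 < S.size x) :
    (mset (fun j => 2 ≤ j) S).genFun = msetM2 S.genFun ∧
    (mset (fun j => 3 ≤ j) S).genFun = msetM3 S.genFun := by
  classical
  let F : ℕ → Finset S.Obj := fun n => (hS n).toFinset
  have hF : ∀ n x, x ∈ F n ↔ S.size x = n := fun n x => by simp [F]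
  let U : ℕ → Finset (Multiset S.Obj) := fun n =>
    (Multiset.finite_sum_map_eq hpos hS n).toFinset
  have hU : ∀ n s, s ∈ U n ↔ (s.map S.size).sum = n := fun n s => by simp [U]
  have hZ : S.genFun = PowerSeries.mk fun n => ((F n).card : ℚ) := by
    ext n
    rw [genFun, coeff_mk, coeff_mk, ← Set.ncard_coe_finset]
    congr 2
    ext x
    simp [hF]
  have hM : msetM S.genFun = PowerSeries.mk fun n => ((U n).card : ℚ) := by
    rw [hZ, msetM_mk_card hpos hF hU]
  have hsplit (n c : ℕ) : ((U n).filter fun s => c ≤ s.card).card =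
      ((U n).filter fun s => c + 1 ≤ s.card).card + ((U n).filter fun s => s.card = c).card := by
    rw [← Finset.card_union_of_disjoint]
    · congr 1
      ext s
      simp only [Finset.mem_filter, Finset.mem_union]
      grind
    · rw [Finset.disjoint_filter]
      intros
      omega
  have h0 (n : ℕ) : ((U n).filter fun s => s.card = 0).card = if n = 0 then 1 else 0 := by
    have : (U n).filter (fun s => s.card = 0) = if n = 0 then {0} else ∅ := by
      ext s
      rw [Finset.mem_filter, hU, Multiset.card_eq_zero]
      split_ifs with h
      · subst h
        rw [Finset.mem_singleton]
        exact ⟨fun h => h.2, by rintro rfl; simp⟩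
      · simp only [Finset.notMem_empty, iff_false]
        rintro ⟨h', rfl⟩
        simp at h'
        omega
    rw [this]
    split_ifs <;> rfl
  have h1 (n : ℕ) : ((U n).filter fun s => s.card = 1).card = (F n).card := by
    refine (Finset.card_bij (fun x _ => {x}) ?_ ?_ ?_).symm
    · intro x hx
      simpa [hU] using (hF n x).1 hx
    · intro x _ y _ h
      exact Multiset.singleton_inj.1 h
    · intro s hs
      rw [Finset.mem_filter, hU, Multiset.card_eq_one] at hs
      obtain ⟨hs, x, rfl⟩ := hs
      exact ⟨x, (hF n x).2 (by simpa using hs), rfl⟩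
  have h2 (n : ℕ) : (((U n).filter fun s => s.card = 2).card : ℚ) =
      coeff n (PowerSeries.C (1 / 2 : ℚ) * (S.genFun ^ 2 + dilate 2 S.genFun)) := by
    have h := congrArg (Nat.cast (R := ℚ)) (Multiset.two_mul_card_filter hF hU n)
    push_cast at h
    rw [coeff_C_mul, map_add, sq, coeff_mul, coeff_dilate (by norm_num), hZ,
      Finset.Nat.sum_antidiagonal_eq_sum_range_succ_mk]
    simp only [coeff_mk]
    have h' : ∑ d ∈ Finset.range (n + 1), ((F d).card : ℚ) * (if 2 * d = n then 1 else 0) =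
        if 2 ∣ n then ((F (n / 2)).card : ℚ) else 0 := by
      split_ifs with hdvd
      · rw [Finset.sum_eq_single (n / 2), if_pos (Nat.mul_div_cancel' hdvd), mul_one]
        · intro d _ hd
          rw [if_neg (by omega), mul_zero]
        · intro hd
          exact absurd (Finset.mem_range.2 (by omega)) hd
      · exact Finset.sum_eq_zero fun d _ => by rw [if_neg (by omega), mul_zero]
    simp only [mul_add, Finset.sum_add_distrib] at h
    rw [h'] at h
    rw [← h]
    ring
  have hge2 (n : ℕ) : (((U n).filter fun s => 2 ≤ s.card).card : ℚ) =
      coeff n (msetM2 S.genFun) := by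
    have h : (U n).card = ((U n).filter fun s => 2 ≤ s.card).card + (F n).card +
        if n = 0 then 1 else 0 := by
      rw [← h0, ← h1, ← hsplit n 1, ← hsplit n 0]
      simp
    rw [msetM2, map_sub, map_sub, hM, hZ, coeff_mk, coeff_mk, coeff_one, h]
    push_cast
    ring
  refine ⟨?_, ?_⟩
  · ext n
    rw [coeff_genFun_mset hU, hge2]
  · ext n
    have h := congrArg (Nat.cast (R := ℚ)) (hsplit n 2)
    push_cast at h
    rw [coeff_genFun_mset hU, msetM3, map_sub, ← h2, ← msetM2, ← hge2, h]
    ring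

/-- A node attached to each of `k` children has total size `k = 1 + (k - 1)`, and `k` is recovered
as the cardinality of the multiset. -/
theorem sizeEquiv_mset_point_pair (T : CombClass) :
    ((point 1).pair (iUnion fun k : {k : ℕ // 2 ≤ k} =>
      (point (k.1 - 1)).pair (mset (fun j => j = k.1) T))).SizeEquiv
    (mset (fun j => 2 ≤ j) ((point 1).pair T)) := by
  let g : T.Obj → ((point 1).pair T).Obj := fun b => ((), b)
  have hg : Function.Injective g := fun b b' h => congrArg Prod.snd h
  let f : ((point 1).pair (iUnion fun k : {k : ℕ // 2 ≤ k} =>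
      (point (k.1 - 1)).pair (mset (fun j => j = k.1) T))).Obj →
      (mset (fun j => 2 ≤ j) ((point 1).pair T)).Obj := fun x =>
    ⟨x.2.2.2.1.map g, by rw [Multiset.card_map, x.2.2.2.2]; exact x.2.1.2⟩
  refine ⟨Equiv.ofBijective f ⟨?_, ?_⟩, ?_⟩
  · rintro ⟨⟨⟩, ⟨k, hk⟩, ⟨⟩, s, hs⟩ ⟨⟨⟩, ⟨k', hk'⟩, ⟨⟩, s', hs'⟩ h
    have h' : s = s' := Multiset.map_injective hg (congrArg Subtype.val h)
    subst h'
    change Multiset.card s = k at hs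
    change Multiset.card s = k' at hs'
    subst hs
    subst hs'
    rfl
  · rintro ⟨s, hs⟩
    refine ⟨((), ⟨⟨s.card, hs⟩, (), ⟨s.map Prod.snd, Multiset.card_map _ _⟩⟩), Subtype.ext ?_⟩
    change (s.map Prod.snd).map g = s
    exact (Multiset.map_map _ _ _).trans (Multiset.map_id s)
  · rintro ⟨⟨⟩, ⟨k, hk⟩, ⟨⟩, s, hs⟩
    change Multiset.card s = k at hs
    change ((s.map g).map ((point 1).pair T).size).sum = 1 + (k - 1 + (s.map T.size).sum)
    have h : (s.map g).map ((point 1).pair T).size = s.map fun b => 1 + T.size b :=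
      Multiset.map_map _ _ _
    rw [h, Multiset.sum_map_add, Multiset.map_const', Multiset.sum_replicate, hs]
    simp only [smul_eq_mul, mul_one]
    omega

end CombClass

-- Finiteness and the functional equations

theorem atomicCohorts_finiteFibers : atomicCohorts.FiniteFibers := by
  intro n
  have h : {w : DyckWord | w.semilength = n}.Finite :=
    Set.finite_coe_iff.1 (Finite.of_fintype {w : DyckWord // w.semilength = n})
  refine Set.Finite.of_finite_image ((h.image Cohort.mk).subset ?_)
    (Subtype.val_injective (p := Cohort.IsAtomic)).injOn
  rintro _ ⟨⟨_, w, hw, rfl⟩, hC, rfl⟩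
  exact ⟨w, hC, rfl⟩

theorem mainTheorem4 :
    -- the classes satisfy the recursive specification
    (classA.SizeEquiv (specA classA classB) ∧ classB.SizeEquiv (specB classA)) ∧
    -- the size-preserving bijection
    atomicCohorts.SizeEquiv classA ∧
    -- the generating functions of the classes are well defined
    (atomicCohorts.FiniteFibers ∧ classB.FiniteFibers) ∧
    -- the functional equation, where `Q` is the quotient of `M_{≥ 2}(t B)` by `t`
    (∃ Q : PowerSeries ℚ,
      PowerSeries.X * Q = msetM2 (PowerSeries.X * classB.genFun) ∧
      atomicCohorts.genFun =
        PowerSeries.X + PowerSeries.X * atomicCohorts.genFun + Q + classB.genFun) ∧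
    classB.genFun = PowerSeries.X * msetM3 atomicCohorts.genFun := by
  have hA := atomicCohorts_sizeEquiv_classA
  have hfA : classA.FiniteFibers := hA.symm.finiteFibers atomicCohorts_finiteFibers
  -- Finiteness passes from cohorts to `𝒜`, then to its specification, and from there to every
  -- summand, including `ℬ`.
  have hspec := classA_sizeEquiv_specA.symm.finiteFibers hfA
  have hf₃ : classB.FiniteFibers := hspec.of_injective Sum.inr Sum.inr_injective 0 fun _ => rfl
  have hf' := hspec.of_injective (S := ((CombClass.point 1).union
    ((CombClass.point 1).pair classA)).union _) Sum.inl Sum.inl_injective 0 fun _ => rfl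
  have hf₂ := hf'.of_injective (S := CombClass.iUnion _) Sum.inr Sum.inr_injective 0 fun _ => rfl
  have hf₁ := hf'.of_injective (S := (CombClass.point 1).union
    ((CombClass.point 1).pair classA)) Sum.inl Sum.inl_injective 0 fun _ => rfl
  have hf₁₁ := hf₁.of_injective (S := CombClass.point 1) Sum.inl Sum.inl_injective 0 fun _ => rfl
  have hf₁₂ := hf₁.of_injective (S := (CombClass.point 1).pair classA) Sum.inr
    Sum.inr_injective 0 fun _ => rfl
  have hfB : ((CombClass.point 1).pair classB).FiniteFibers := by
    intro n
    refine ((hf₃ (n - 1)).image fun b => ((), b)).subset ?_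
    rintro ⟨⟨⟩, b⟩ (hb : 1 + classB.size b = n)
    exact ⟨b, show classB.size b = n - 1 by omega, rfl⟩
  refine ⟨⟨classA_sizeEquiv_specA, classB_sizeEquiv_specB⟩, hA,
    ⟨atomicCohorts_finiteFibers, hf₃⟩, ⟨(CombClass.iUnion fun k : {k : ℕ // 2 ≤ k} =>
      (CombClass.point (k.1 - 1)).pair
        (CombClass.mset (fun j => j = k.1) classB)).genFun, ?_, ?_⟩, ?_⟩
  · rw [← pow_one (PowerSeries.X : PowerSeries ℚ), ← CombClass.genFun_point_pair,
      ← CombClass.genFun_point_pair, (CombClass.sizeEquiv_mset_point_pair classB).genFun_eq]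
    exact (CombClass.genFun_mset hfB fun x => Nat.lt_add_right _ Nat.one_pos).1
  · rw [hA.genFun_eq]
    conv_lhs => rw [classA_sizeEquiv_specA.genFun_eq, specA, CombClass.genFun_union hf' hf₃,
      CombClass.genFun_union hf₁ hf₂, CombClass.genFun_union hf₁₁ hf₁₂,
      CombClass.genFun_point_pair, CombClass.genFun_point, pow_one]
  · rw [hA.genFun_eq, ← (CombClass.genFun_mset hfA TreeA.size_pos).2]
    conv_lhs => rw [classB_sizeEquiv_specB.genFun_eq, specB, CombClass.genFun_point_pair, pow_one]
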